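/- Let $K$ be a field and let $R$ be an associative $K$-algebra, not necessarily with identity. Let $X$ be a set and, for each $x\in X$, let $\sigma_x$ be a $K$-algebra automorphism of $R$ and let $\delta_x\colon R\to R$ be a $K$-linear $\sigma_x$-derivation, i.e. $\delta_x(ab)=\delta_x(a)b+\sigma_x(a)\delta_x(b)$ for all $a,b\in R$. Put $\mathscr G=\{\sigma_x\}_{x\in X}$ and $\mathscr D=\{\delta_x\}_{x\in X}$. Let $R[X;\mathscr G,\mathscr D]$ be the free skew extension of $R$: the ring of all polynomials $\sum_w r_w w$ (finite sums, $r_w\in R$, $w$ in the free monoid $\langle X\rangle$), with the usual addition and with the multiplication determined by the rule $xr=\sigma_x(r)x+\delta_x(r)$ for $x\in X$, $r\in R$. Let $P$ be the prime radical of $R$, i.e. the intersection of all prime ideals of $R$, and let $P[X;\mathscr G,\mathscr D]$ be the set of all polynomials in $R[X;\mathscr G,\mathscr D]$ with all coefficients in $P$. Assume that: 1. the family $\mathscr G$ is locally finite, i.e. for every finite subset $G_0\subseteq\mathscr G$ and every finitely generated $K$-submodule $V$ of $R$, the $K$-submodule of $R$ spanned by all $\sigma(v)$, with $v\in V$ and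 $\sigma$ in the group generated by $G_0$, is finitely generated; 2. for every $x\in X$ there is $q_x\in K^\times$ with $\delta_x\sigma_x=q_x\sigma_x\delta_x$; 3. $1+q_x+\dots+q_x^n\neq 0$ for all $x\in X$ and all $n>0$. Then $P[X;\mathscr G,\mathscr D]$ is a two-sided ideal of $R[X;\mathscr G,\mathscr D]$, closed under multiplication by scalars from $K$, and it is locally nilpotent: each of its finitely generated subrings is a nilpotent ring. -/

import Mathlib

noncomputable section

/-- A `σ`-derivation of a (not necessarily unital) ring `R`: an additive map `δ` with
`δ (a b) = δ a · b + σ a · δ b`. -/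
structure SkewDerivation {R : Type*} [NonUnitalRing R] (σ : RingAut R) extends R →+ R where
  leibniz : ∀ a b : R, toFun (a * b) = toFun a * b + σ a * toFun b

instance {R : Type*} [NonUnitalRing R] {σ : RingAut R} :
    CoeFun (SkewDerivation σ) (fun _ => R → R) :=
  ⟨fun δ => δ.toAddMonoidHom⟩

/-- A family of automorphisms of a `K`-algebra `R` is locally finite if, for every finite set `G₀`
of its members and every finitely generated submodule `V`, the submodule spanned by the translates
of `V` under the group generated by `G₀` is finitely generated. -/
def IsLocallyFiniteFamily (K : Type*) {R X : Type*} [Field K] [NonUnitalRing R] [Module K R]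
    (σ : X → RingAut R) : Prop :=
  ∀ G₀ : Set (RingAut R), G₀ ⊆ Set.range σ → G₀.Finite →
    ∀ V : Submodule K R, V.FG →
      (Submodule.span K {r : R | ∃ g ∈ Subgroup.closure G₀, ∃ v ∈ V, r = g v}).FG

/-- A proper ideal `Q` of a (not necessarily unital or commutative) ring is prime if `A B ⊆ Q`
implies `A ⊆ Q` or `B ⊆ Q`, for all two-sided ideals `A` and `B`. -/
def TwoSidedIdeal.IsPrimeIdeal {R : Type*} [NonUnitalRing R] (Q : TwoSidedIdeal R) : Prop :=
  Q ≠ ⊤ ∧ ∀ A B : TwoSidedIdeal R, (∀ a ∈ A, ∀ b ∈ B, a * b ∈ Q) → A ≤ Q ∨ B ≤ Q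

/-- The prime radical: the intersection of all prime ideals (all of `R` if there are none). -/
def primeRadical (R : Type*) [NonUnitalRing R] : TwoSidedIdeal R :=
  sInf {Q : TwoSidedIdeal R | Q.IsPrimeIdeal}

/-- A ring is nilpotent if, for some `n`, every product `a₀ a₁ ⋯ aₙ` of `n + 1` elements is zero. -/
def IsNilpotentRing (A : Type*) [NonUnitalRing A] : Prop :=
  ∃ n : ℕ, ∀ (a : A) (l : List A), l.length = n → l.foldl (· * ·) a = 0

/-- A ring is locally nilpotent if every finitely generated subring is a nilpotent ring
(subrings need not contain an identity). -/
def IsLocallyNilpotentRing (A : Type*) [NonUnitalRing A] : Prop :=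
  ∀ s : Finset A, IsNilpotentRing (NonUnitalSubring.closure (s : Set A))

namespace FreeSkew

section Operators

variable {R X : Type*} [NonUnitalRing R]

/-- Left multiplication of polynomials by a coefficient: `a · ∑ r_w w = ∑ (a r_w) w`. -/
def coeffMul : R →+ AddMonoid.End (FreeMonoid X →₀ R) where
  toFun a := Finsupp.mapRange.addMonoidHom (AddMonoidHom.mulLeft a)
  map_zero' := by
    refine Finsupp.addHom_ext fun w r => Finsupp.ext fun v => ?_
    exact zero_mul _
  map_add' a b := by
    refine Finsupp.addHom_ext fun w r => Finsupp.ext fun v => ?_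
    exact add_mul _ _ _

/-- Left multiplication of polynomials by a variable:
`x · ∑ r_w w = ∑ (σ_x(r_w) x w + δ_x(r_w) w)`. -/
def varMul (σ : X → RingAut R) (δ : ∀ x, SkewDerivation (σ x)) (x : X) :
    AddMonoid.End (FreeMonoid X →₀ R) :=
  (Finsupp.mapDomain.addMonoidHom (fun w => FreeMonoid.of x * w)).comp
      (Finsupp.mapRange.addMonoidHom (σ x : R →+ R)) +
    Finsupp.mapRange.addMonoidHom (δ x).toAddMonoidHom

/-- Left multiplication by a polynomial: `(∑ r_w w) · g = ∑ r_w · (w · g)`, where a word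
`w = x₁ ⋯ xₘ` acts through its letters. -/
def polyMul (σ : X → RingAut R) (δ : ∀ x, SkewDerivation (σ x)) :
    (FreeMonoid X →₀ R) →+ AddMonoid.End (FreeMonoid X →₀ R) :=
  Finsupp.liftAddHom fun w =>
    (AddMonoidHom.mulRight (FreeMonoid.lift (varMul σ δ) w)).comp coeffMul

variable (σ : X → RingAut R) (δ : ∀ x, SkewDerivation (σ x))

theorem end_mul_apply {M : Type*} [AddCommGroup M] (f g : AddMonoid.End M) (m : M) :
    (f * g) m = f (g m) := rfl

theorem end_add_apply {M : Type*} [AddCommGroup M] (f g : AddMonoid.End M) (m : M) :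
    (f + g) m = f m + g m := rfl

theorem end_ext {f g : AddMonoid.End (FreeMonoid X →₀ R)}
    (h : ∀ w r, f (Finsupp.single w r) = g (Finsupp.single w r)) : f = g :=
  Finsupp.addHom_ext h

theorem coeffMul_single (a : R) (w : FreeMonoid X) (r : R) :
    coeffMul a (Finsupp.single w r) = Finsupp.single w (a * r) := by
  exact Finsupp.mapRange_single (hf := map_zero (AddMonoidHom.mulLeft a))

theorem varMul_single (x : X) (w : FreeMonoid X) (r : R) :
    varMul σ δ x (Finsupp.single w r) =
      Finsupp.single (FreeMonoid.of x * w) (σ x r) + Finsupp.single w (δ x r) := by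
  change Finsupp.mapDomain (fun w => FreeMonoid.of x * w)
      (Finsupp.mapRange.addMonoidHom (σ x : R →+ R) (Finsupp.single w r)) +
    Finsupp.mapRange.addMonoidHom (δ x).toAddMonoidHom (Finsupp.single w r) = _
  simp [Finsupp.mapDomain_single]

theorem polyMul_single (w : FreeMonoid X) (r : R) :
    polyMul σ δ (Finsupp.single w r) = coeffMul r * FreeMonoid.lift (varMul σ δ) w := by
  simp [polyMul]

theorem coeffMul_mul (a b : R) :
    (coeffMul (a * b) : AddMonoid.End (FreeMonoid X →₀ R)) = coeffMul a * coeffMul b := by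
  refine end_ext fun w r => ?_
  simp only [end_mul_apply, coeffMul_single, mul_assoc]

theorem varMul_mul_coeffMul (x : X) (a : R) :
    varMul σ δ x * coeffMul a =
      coeffMul (σ x a) * varMul σ δ x + coeffMul (δ x a) := by
  refine end_ext fun w r => ?_
  have h : δ x (a * r) = δ x a * r + σ x a * δ x r := (δ x).leibniz a r
  simp only [end_mul_apply, end_add_apply, coeffMul_single, varMul_single,
    map_add, map_mul]
  rw [h, Finsupp.single_add]
  abel

theorem polyMul_coeffMul (a : R) (g : FreeMonoid X →₀ R) :
    polyMul σ δ (coeffMul a g) = coeffMul a * polyMul σ δ g := by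
  induction g using Finsupp.induction_linear with
  | zero => simp
  | add f g hf hg => simp only [map_add, hf, hg, mul_add]
  | single w r => rw [coeffMul_single, polyMul_single, polyMul_single, coeffMul_mul, mul_assoc]

theorem polyMul_varMul (x : X) (g : FreeMonoid X →₀ R) :
    polyMul σ δ (varMul σ δ x g) = varMul σ δ x * polyMul σ δ g := by
  induction g using Finsupp.induction_linear with
  | zero => simp
  | add f g hf hg => simp only [map_add, hf, hg, mul_add]
  | single w r =>
    rw [varMul_single, map_add, polyMul_single, polyMul_single, polyMul_single, ← mul_assoc,
      varMul_mul_coeffMul, map_mul, FreeMonoid.lift_eval_of, add_mul, mul_assoc]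

theorem polyMul_word (w : FreeMonoid X) (g : FreeMonoid X →₀ R) :
    polyMul σ δ (FreeMonoid.lift (varMul σ δ) w g) =
      FreeMonoid.lift (varMul σ δ) w * polyMul σ δ g := by
  induction w using FreeMonoid.inductionOn' with
  | one => simp
  | of_mul x w ih =>
    rw [map_mul, FreeMonoid.lift_eval_of, end_mul_apply, polyMul_varMul, ih, mul_assoc]

theorem polyMul_polyMul (f g : FreeMonoid X →₀ R) :
    polyMul σ δ (polyMul σ δ f g) = polyMul σ δ f * polyMul σ δ g := by
  induction f using Finsupp.induction_linear with
  | zero => simp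
  | add f₁ f₂ h₁ h₂ => simp only [map_add, end_add_apply, h₁, h₂, add_mul]
  | single w r =>
    rw [polyMul_single, end_mul_apply, polyMul_coeffMul, polyMul_word, mul_assoc]

end Operators

end FreeSkew

/-- The free skew extension `R[X; σ, δ]`: polynomials `∑ r_w w` in noncommuting variables, with
coefficients `r_w ∈ R` on the left of the words `w`, multiplied by the rule
`x r = σ_x(r) x + δ_x(r)`. -/
@[nolint unusedArguments]
def FreeSkewExtension {R X : Type*} [NonUnitalRing R] (σ : X → RingAut R)
    (_δ : ∀ x, SkewDerivation (σ x)) : Type _ :=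
  FreeMonoid X →₀ R

namespace FreeSkewExtension

variable {R X : Type*} [NonUnitalRing R] {σ : X → RingAut R} {δ : ∀ x, SkewDerivation (σ x)}

instance : AddCommGroup (FreeSkewExtension σ δ) :=
  inferInstanceAs (AddCommGroup (FreeMonoid X →₀ R))

instance {K : Type*} [Field K] [Module K R] : Module K (FreeSkewExtension σ δ) :=
  inferInstanceAs (Module K (FreeMonoid X →₀ R))

instance : NonUnitalRing (FreeSkewExtension σ δ) :=
  { (inferInstance : AddCommGroup (FreeSkewExtension σ δ)) with
    mul := fun f g => FreeSkew.polyMul σ δ f g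
    left_distrib := fun f g h => map_add (FreeSkew.polyMul σ δ f) g h
    right_distrib := fun f g h =>
      DFunLike.congr_fun (map_add (FreeSkew.polyMul σ δ) f g) h
    zero_mul := fun f => DFunLike.congr_fun (map_zero (FreeSkew.polyMul σ δ)) f
    mul_zero := fun f => map_zero (FreeSkew.polyMul σ δ f)
    mul_assoc := fun f g h =>
      DFunLike.congr_fun (FreeSkew.polyMul_polyMul σ δ f g) h }

/-- The coefficient of a polynomial at a word. -/
def coeff (f : FreeSkewExtension σ δ) (w : FreeMonoid X) : R :=
  (show FreeMonoid X →₀ R from f) w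

/-- The monomial `r w`. -/
def monomial (w : FreeMonoid X) (r : R) : FreeSkewExtension σ δ :=
  (Finsupp.single w r : FreeMonoid X →₀ R)

theorem monomial_one_mul_monomial (a b : R) (v : FreeMonoid X) :
    (monomial 1 a * monomial v b : FreeSkewExtension σ δ) = monomial v (a * b) := by
  change FreeSkew.polyMul σ δ (Finsupp.single 1 a) (Finsupp.single v b) = Finsupp.single v (a * b)
  rw [FreeSkew.polyMul_single, map_one, mul_one, FreeSkew.coeffMul_single]

/-- The defining rule `(a x) (b v) = a σ_x(b) x v + a δ_x(b) v`. -/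
theorem monomial_of_mul_monomial (x : X) (a b : R) (v : FreeMonoid X) :
    (monomial (FreeMonoid.of x) a * monomial v b : FreeSkewExtension σ δ) =
      monomial (FreeMonoid.of x * v) (a * σ x b) + monomial v (a * δ x b) := by
  change FreeSkew.polyMul σ δ (Finsupp.single (FreeMonoid.of x) a) (Finsupp.single v b) =
    (Finsupp.single (FreeMonoid.of x * v) (a * σ x b) + Finsupp.single v (a * δ x b) :
      FreeMonoid X →₀ R)
  rw [FreeSkew.polyMul_single, FreeMonoid.lift_eval_of, FreeSkew.end_mul_apply,
    FreeSkew.varMul_single, map_add, FreeSkew.coeffMul_single, FreeSkew.coeffMul_single]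

/-- The set `P[X; σ, δ]` of polynomials all of whose coefficients lie in the ideal `P` of `R`. -/
def polynomialsOver (σ : X → RingAut R) (δ : ∀ x, SkewDerivation (σ x)) (P : TwoSidedIdeal R) :
    Set (FreeSkewExtension σ δ) :=
  {f | ∀ w : FreeMonoid X, f.coeff w ∈ P}

end FreeSkewExtension

end

/-!
The prime radical `P` is reached from below by Baer's transfinite construction: start with `0`, pass
from an ideal `T` to the sum of all ideals nilpotent modulo `T`, and take unions of chains. Every
stage `T` is stable under all `σ x` and `δ x`, and `T[X; σ, δ]` is locally nilpotent.

Stability passes to the next stage by the `q`-Leibniz rule. For `a ∈ N` and `b ∈ N ^ n`,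
`δ ^ (n + 1) (a b) ≡ (1 + q + ⋯ + q ^ n) σ ^ n (δ a) δ ^ n b` modulo `N`, and the first factor is
invertible, so that the ideal `δ N + N` is nilpotent modulo `T` together with `N`; local finiteness
of `σ` is what allows one to take `N` invariant under `σ`.

Local nilpotence passes to the next stage by counting degrees. The coefficients of a product of `n`
polynomials of degree at most `d` are sums of products of `n` elements on which the derivations act
at most `n d` times in total, so more than half of these elements have been hit at most `2 d` times.
By local finiteness all elements of the latter kind lie in one finitely generated submodule, hence
in one ideal nilpotent modulo `T`.
-/

noncomputable section

section AlgebraIdeals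

variable {K R : Type*} [CommRing K] [NonUnitalRing R] [Module K R]

/-- A two-sided algebra ideal of `R`: a `K`-submodule stable under multiplication by `R` on both
sides. It is a predicate on submodules so that spans and finite generation over `K` are at hand. -/
structure IsAlgebraIdeal (N : Submodule K R) : Prop where
  mul_mem_left : ∀ r : R, ∀ a ∈ N, r * a ∈ N
  mul_mem_right : ∀ a ∈ N, ∀ r : R, a * r ∈ N

theorem isAlgebraIdeal_top : IsAlgebraIdeal (⊤ : Submodule K R) :=
  ⟨fun _ _ _ => trivial, fun _ _ _ => trivial⟩

theorem isAlgebraIdeal_bot : IsAlgebraIdeal (⊥ : Submodule K R) where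
  mul_mem_left r a ha := by rw [(Submodule.mem_bot K).1 ha, mul_zero]; exact zero_mem _
  mul_mem_right a ha r := by rw [(Submodule.mem_bot K).1 ha, zero_mul]; exact zero_mem _

/-- An algebra ideal as a two-sided ideal of the ring `R`, to which the notion of prime ideal
applies. -/
def IsAlgebraIdeal.toTwoSidedIdeal {N : Submodule K R} (hN : IsAlgebraIdeal N) : TwoSidedIdeal R :=
  .mk' N N.zero_mem N.add_mem N.neg_mem (fun {_ _} => hN.mul_mem_left _ _)
    (fun {_ _} h => hN.mul_mem_right _ h _)

theorem IsAlgebraIdeal.mem_toTwoSidedIdeal {N : Submodule K R} (hN : IsAlgebraIdeal N) {a : R} :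
    a ∈ hN.toTwoSidedIdeal ↔ a ∈ N :=
  TwoSidedIdeal.mem_mk' ..

variable [IsScalarTower K R R] [SMulCommClass K R R]

theorem IsAlgebraIdeal.sSup {c : Set (Submodule K R)} (hc : ∀ N ∈ c, IsAlgebraIdeal N) :
    IsAlgebraIdeal (sSup c) where
  mul_mem_left r a ha := by
    have hle : SupSet.sSup c ≤ (SupSet.sSup c).comap (LinearMap.mulLeft K r) :=
      sSup_le fun N hN b hb => le_sSup hN ((hc N hN).mul_mem_left r b hb)
    exact hle ha
  mul_mem_right a ha r := by
    have hle : SupSet.sSup c ≤ (SupSet.sSup c).comap (LinearMap.mulRight K r) :=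
      sSup_le fun N hN b hb => le_sSup hN ((hc N hN).mul_mem_right b hb r)
    exact hle ha

theorem IsAlgebraIdeal.sup {M N : Submodule K R} (hM : IsAlgebraIdeal M) (hN : IsAlgebraIdeal N) :
    IsAlgebraIdeal (M ⊔ N) := by
  rw [← sSup_pair]
  exact .sSup (by rintro _ (rfl | rfl) <;> assumption)

theorem isAlgebraIdeal_span (I : TwoSidedIdeal R) :
    IsAlgebraIdeal (Submodule.span K (I : Set R)) where
  mul_mem_left r a ha := by
    have hle : Submodule.span K (I : Set R) ≤
        (Submodule.span K (I : Set R)).comap (LinearMap.mulLeft K r) :=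
      Submodule.span_le.2 fun _ hb => Submodule.subset_span (I.mul_mem_left _ _ hb)
    exact hle ha
  mul_mem_right a ha r := by
    have hle : Submodule.span K (I : Set R) ≤
        (Submodule.span K (I : Set R)).comap (LinearMap.mulRight K r) :=
      Submodule.span_le.2 fun _ hb => Submodule.subset_span (I.mul_mem_right _ _ hb)
    exact hle ha

/-- The submodule `N (N (⋯ (N R)))`, with `n` factors `N`. The last factor `R` makes sense of the
power `0` in the absence of an identity. -/
def leftPow (N : Submodule K R) : ℕ → Submodule K R
  | 0 => ⊤
  | n + 1 => Submodule.map₂ (LinearMap.mul K R) N (leftPow N n)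

theorem mul_mem_leftPow {N : Submodule K R} {n : ℕ} {a b : R} (ha : a ∈ N)
    (hb : b ∈ leftPow N n) : a * b ∈ leftPow N (n + 1) :=
  Submodule.apply_mem_map₂ (LinearMap.mul K R) ha hb

theorem leftPow_succ_le {N M : Submodule K R} {n : ℕ} :
    leftPow N (n + 1) ≤ M ↔ ∀ a ∈ N, ∀ b ∈ leftPow N n, a * b ∈ M :=
  Submodule.map₂_le

theorem leftPow_mono {M N : Submodule K R} (h : M ≤ N) (n : ℕ) : leftPow M n ≤ leftPow N n := by
  induction n with
  | zero => exact le_rfl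
  | succ n ih => exact Submodule.map₂_le_map₂ h ih

theorem IsAlgebraIdeal.map₂ {M N : Submodule K R} (hM : IsAlgebraIdeal M) (hN : IsAlgebraIdeal N) :
    IsAlgebraIdeal (Submodule.map₂ (LinearMap.mul K R) M N) where
  mul_mem_left r c hc := by
    have hle : Submodule.map₂ (LinearMap.mul K R) M N ≤
        (Submodule.map₂ (LinearMap.mul K R) M N).comap (LinearMap.mulLeft K r) :=
      Submodule.map₂_le.2 fun a ha b hb => by
        change r * (a * b) ∈ Submodule.map₂ (LinearMap.mul K R) M N
        rw [← mul_assoc]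
        exact Submodule.apply_mem_map₂ (LinearMap.mul K R) (hM.mul_mem_left r a ha) hb
    exact hle hc
  mul_mem_right c hc r := by
    have hle : Submodule.map₂ (LinearMap.mul K R) M N ≤
        (Submodule.map₂ (LinearMap.mul K R) M N).comap (LinearMap.mulRight K r) :=
      Submodule.map₂_le.2 fun a ha b hb => by
        change a * b * r ∈ Submodule.map₂ (LinearMap.mul K R) M N
        rw [mul_assoc]
        exact Submodule.apply_mem_map₂ (LinearMap.mul K R) ha (hN.mul_mem_right b hb r)
    exact hle hc

theorem IsAlgebraIdeal.leftPow {N : Submodule K R} (hN : IsAlgebraIdeal N) (n : ℕ) :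
    IsAlgebraIdeal (leftPow N n) := by
  induction n with
  | zero => exact isAlgebraIdeal_top
  | succ n ih => exact hN.map₂ ih

theorem leftPow_sup_le (N : Submodule K R) {M : Submodule K R} (hM : IsAlgebraIdeal M) (n : ℕ) :
    leftPow (N ⊔ M) n ≤ leftPow N n ⊔ M := by
  induction n with
  | zero => exact le_sup_left
  | succ n ih =>
    refine leftPow_succ_le.2 fun a ha b hb => ?_
    obtain ⟨c, hc, m, hm, rfl⟩ := Submodule.mem_sup.1 ha
    obtain ⟨d, hd, k, hk, rfl⟩ := Submodule.mem_sup.1 (ih hb)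
    rw [add_mul, mul_add, add_assoc]
    exact Submodule.add_mem_sup (mul_mem_leftPow hc hd)
      (add_mem (hM.mul_mem_left c k hk) (hM.mul_mem_right m hm (d + k)))

theorem leftPow_add_succ_le (N : Submodule K R) (n k : ℕ) :
    leftPow N (n + 1 + k) ≤
      Submodule.map₂ (LinearMap.mul K R) (leftPow N n) (leftPow N k) := by
  induction n with
  | zero =>
    rw [zero_add, add_comm]
    exact Submodule.map₂_le_map₂_left le_top
  | succ n ih =>
    rw [show n + 1 + 1 + k = n + 1 + k + 1 by omega]
    refine leftPow_succ_le.2 fun a ha b hb => ?_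
    have hle : Submodule.map₂ (LinearMap.mul K R) (leftPow N n) (leftPow N k) ≤
        (Submodule.map₂ (LinearMap.mul K R) (leftPow N (n + 1)) (leftPow N k)).comap
          (LinearMap.mulLeft K a) := by
      refine Submodule.map₂_le.2 fun c hc d hd => ?_
      change a * (c * d) ∈ Submodule.map₂ (LinearMap.mul K R) (leftPow N (n + 1)) (leftPow N k)
      rw [← mul_assoc]
      exact Submodule.apply_mem_map₂ (LinearMap.mul K R) (mul_mem_leftPow ha hc) hd
    exact hle (ih hb)

end AlgebraIdeals

section NilpotentModulo

variable {K R : Type*} [CommRing K] [NonUnitalRing R] [Module K R] [IsScalarTower K R R]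
  [SMulCommClass K R R]

/-- `N` is nilpotent modulo `T`: some power of `N` lies in `T`. Measuring powers by `leftPow`
instead of by products of elements of `N` shifts the exponent by at most one. -/
def IsNilpotentMod (N T : Submodule K R) : Prop := ∃ n, leftPow N n ≤ T

theorem IsAlgebraIdeal.isNilpotentMod_self {T : Submodule K R} (hT : IsAlgebraIdeal T) :
    IsNilpotentMod T T :=
  ⟨1, leftPow_succ_le.2 fun a ha b _ => hT.mul_mem_right a ha b⟩

theorem IsNilpotentMod.mono {M N T : Submodule K R} (h : IsNilpotentMod N T) (hMN : M ≤ N) :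
    IsNilpotentMod M T :=
  h.imp fun n hn => (leftPow_mono hMN n).trans hn

theorem IsNilpotentMod.trans {M N T : Submodule K R} (hMN : IsNilpotentMod M N)
    (hNT : IsNilpotentMod N T) : IsNilpotentMod M T := by
  obtain ⟨n, hn⟩ := hMN
  obtain ⟨m, hm⟩ := hNT
  have hpow : ∀ m, leftPow M ((n + 1) * m) ≤ leftPow N m := fun m => by
    induction m with
    | zero => exact le_rfl
    | succ m ih =>
      rw [mul_add_one, add_comm]
      exact (leftPow_add_succ_le M n _).trans (Submodule.map₂_le_map₂ hn ih)
  exact ⟨(n + 1) * m, (hpow m).trans hm⟩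

theorem IsNilpotentMod.sup_self {N T : Submodule K R} (hT : IsAlgebraIdeal T)
    (h : IsNilpotentMod N T) : IsNilpotentMod (N ⊔ T) T :=
  h.imp fun n hn => (leftPow_sup_le N hT n).trans (sup_le hn le_rfl)

theorem IsNilpotentMod.sup {M N T : Submodule K R} (hT : IsAlgebraIdeal T)
    (hN : IsAlgebraIdeal N) (hMNT : IsNilpotentMod M (N ⊔ T)) (hNT : IsNilpotentMod N T) :
    IsNilpotentMod (M ⊔ N) T := by
  obtain ⟨n, hn⟩ := hMNT
  refine IsNilpotentMod.trans ⟨n, ?_⟩ (hNT.sup_self hT)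
  exact (leftPow_sup_le M hN n).trans (sup_le hn le_sup_left)

/-- The sum of all algebra ideals that are nilpotent modulo `T`: one step in Baer's construction
of the prime radical from below. -/
def nilSum (T : Submodule K R) : Submodule K R :=
  sSup {N | IsAlgebraIdeal N ∧ IsNilpotentMod N T}

theorem le_nilSum {N T : Submodule K R} (hN : IsAlgebraIdeal N) (h : IsNilpotentMod N T) :
    N ≤ nilSum T :=
  le_sSup ⟨hN, h⟩

theorem nilSum_mono {T T' : Submodule K R} (h : T ≤ T') : nilSum T ≤ nilSum T' :=
  sSup_le_sSup fun _ hN => ⟨hN.1, hN.2.imp fun _ hn => hn.trans h⟩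

theorem IsAlgebraIdeal.le_nilSum_self {T : Submodule K R} (hT : IsAlgebraIdeal T) :
    T ≤ nilSum T :=
  le_nilSum hT hT.isNilpotentMod_self

theorem isAlgebraIdeal_nilSum (T : Submodule K R) : IsAlgebraIdeal (nilSum T) :=
  .sSup fun _ hN => hN.1

theorem exists_isNilpotentMod_of_fg_le_nilSum {T V : Submodule K R} (hT : IsAlgebraIdeal T)
    (hV : V.FG) (hVT : V ≤ nilSum T) : ∃ N, IsAlgebraIdeal N ∧ IsNilpotentMod N T ∧ V ≤ N := by
  let c : Set (Submodule K R) := {N | IsAlgebraIdeal N ∧ IsNilpotentMod N T}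
  have hdir : DirectedOn (· ≤ ·) c :=
    fun M hM N hN => ⟨M ⊔ N, ⟨hM.1.sup hN.1, IsNilpotentMod.sup hT hN.1
      (hM.2.imp fun _ hn => hn.trans le_sup_right) hN.2⟩, le_sup_left, le_sup_right⟩
  obtain ⟨N, ⟨hN, hNT⟩, hVN⟩ := (CompleteLattice.isCompactElement_iff_le_of_directed_sSup_le _ V).1
    ((Submodule.fg_iff_compact V).1 hV) c ⟨T, hT, hT.isNilpotentMod_self⟩ hdir hVT
  exact ⟨N, hN, hNT, hVN⟩

end NilpotentModulo

section PrimeIdeals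

variable {R : Type*} [NonUnitalRing R]

theorem exists_mem_iff_of_isChain {c : Set (TwoSidedIdeal R)} (hc : IsChain (· ≤ ·) c)
    (hne : c.Nonempty) : ∃ J : TwoSidedIdeal R, ∀ a, a ∈ J ↔ ∃ I ∈ c, a ∈ I := by
  refine ⟨.mk' {a | ∃ I ∈ c, a ∈ I} ?zero ?add ?neg ?left ?right, fun a => TwoSidedIdeal.mem_mk' ..⟩
  case zero =>
    obtain ⟨I, hI⟩ := hne
    exact ⟨I, hI, I.zero_mem⟩
  case add =>
    rintro x y ⟨I, hI, hx⟩ ⟨I', hI', hy⟩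
    rcases hc.total hI hI' with h | h
    · exact ⟨I', hI', I'.add_mem (h hx) hy⟩
    · exact ⟨I, hI, I.add_mem hx (h hy)⟩
  case neg =>
    rintro x ⟨I, hI, hx⟩
    exact ⟨I, hI, I.neg_mem hx⟩
  case left =>
    rintro x y ⟨I, hI, hy⟩
    exact ⟨I, hI, I.mul_mem_left _ _ hy⟩
  case right =>
    rintro x y ⟨I, hI, hx⟩
    exact ⟨I, hI, I.mul_mem_right _ _ hx⟩

theorem span_singleton_le_iff_mem {I : TwoSidedIdeal R} {a : R} :
    TwoSidedIdeal.span {a} ≤ I ↔ a ∈ I :=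
  TwoSidedIdeal.span_le.trans Set.singleton_subset_iff

/-- An m-system, the noncommutative analogue of a multiplicative set: the complement of an ideal
is an m-system exactly when the ideal is prime or the whole ring. The usual condition `a r b ∈ S`
is weakened to products of elements of the ideals generated by `a` and `b`, since `R` need not have
an identity. -/
def IsMSystem (S : Set R) : Prop :=
  ∀ a ∈ S, ∀ b ∈ S, ∃ u ∈ TwoSidedIdeal.span {a}, ∃ v ∈ TwoSidedIdeal.span {b}, u * v ∈ S

theorem mul_mem_of_mem_sup {Q A B : TwoSidedIdeal R} (hAB : ∀ a ∈ A, ∀ b ∈ B, a * b ∈ Q) {u v : R}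
    (hu : u ∈ Q ⊔ A) (hv : v ∈ Q ⊔ B) : u * v ∈ Q := by
  obtain ⟨x, hx, a, ha, rfl⟩ := TwoSidedIdeal.mem_sup.1 hu
  obtain ⟨y, hy, b, hb, rfl⟩ := TwoSidedIdeal.mem_sup.1 hv
  rw [add_mul, mul_add a]
  exact Q.add_mem (Q.mul_mem_right _ _ hx) (Q.add_mem (Q.mul_mem_left _ _ hy) (hAB a ha b hb))

theorem IsMSystem.isPrimeIdeal_of_maximal {S : Set R} (hS : IsMSystem S) (hne : S.Nonempty)
    {Q : TwoSidedIdeal R} (hQ : Maximal (fun I : TwoSidedIdeal R => Disjoint (I : Set R) S) Q) :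
    Q.IsPrimeIdeal := by
  have hmeet : ∀ A : TwoSidedIdeal R, ¬ A ≤ Q → ∃ a ∈ Q ⊔ A, a ∈ S := fun A hA => by
    contrapose! hA
    exact le_sup_right.trans (hQ.le_of_ge (Set.disjoint_left.2 hA) le_sup_left)
  refine ⟨?_, fun A B hAB => ?_⟩
  · rintro rfl
    obtain ⟨a, ha⟩ := hne
    exact Set.disjoint_left.1 hQ.prop trivial ha
  · by_contra! h
    obtain ⟨a, haQ, haS⟩ := hmeet A h.1
    obtain ⟨b, hbQ, hbS⟩ := hmeet B h.2
    obtain ⟨u, hu, v, hv, huv⟩ := hS a haS b hbS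
    exact Set.disjoint_left.1 hQ.prop (mul_mem_of_mem_sup hAB
      (span_singleton_le_iff_mem.2 haQ hu) (span_singleton_le_iff_mem.2 hbQ hv)) huv

theorem IsMSystem.exists_isPrimeIdeal_disjoint {S : Set R} (hS : IsMSystem S) (hne : S.Nonempty)
    {T : TwoSidedIdeal R} (hT : Disjoint (T : Set R) S) :
    ∃ Q : TwoSidedIdeal R, Q.IsPrimeIdeal ∧ T ≤ Q ∧ Disjoint (Q : Set R) S := by
  obtain ⟨Q, hTQ, hQ⟩ := zorn_le_nonempty₀ {I : TwoSidedIdeal R | Disjoint (I : Set R) S}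
    (fun c hcS hc I hI => by
      obtain ⟨J, hJ⟩ := exists_mem_iff_of_isChain hc ⟨I, hI⟩
      refine ⟨J, Set.disjoint_left.2 fun a haJ haS => ?_, fun I hI a ha => (hJ a).2 ⟨I, hI, ha⟩⟩
      obtain ⟨I', hI', haI'⟩ := (hJ a).1 haJ
      exact Set.disjoint_left.1 (hcS hI') haI' haS) T hT
  exact ⟨Q, hS.isPrimeIdeal_of_maximal hne hQ, hTQ, hQ.prop⟩

/-- A semiprime ideal: it contains every ideal whose square it contains. -/
def IsSemiprimeIdeal (T : TwoSidedIdeal R) : Prop :=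
  ∀ A : TwoSidedIdeal R, (∀ a ∈ A, ∀ b ∈ A, a * b ∈ T) → A ≤ T

theorem IsSemiprimeIdeal.exists_mul_notMem {T : TwoSidedIdeal R} (hT : IsSemiprimeIdeal T) {a : R}
    (ha : a ∉ T) : ∃ u ∈ TwoSidedIdeal.span {a}, ∃ v ∈ TwoSidedIdeal.span {a}, u * v ∉ T := by
  contrapose! ha
  exact hT _ ha (TwoSidedIdeal.subset_span rfl)

theorem IsSemiprimeIdeal.exists_isMSystem {T : TwoSidedIdeal R} (hT : IsSemiprimeIdeal T) {a : R}
    (ha : a ∉ T) : ∃ S : Set R, a ∈ S ∧ IsMSystem S ∧ Disjoint (T : Set R) S := by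
  choose! u hu v hv huv using fun b (hb : b ∉ T) => hT.exists_mul_notMem hb
  let s : ℕ → R := fun n => n.rec a fun _ b => u b * v b
  have hs : ∀ n, s n ∉ T := fun n => by
    induction n with
    | zero => exact ha
    | succ n ih => exact huv _ ih
  have hanti : Antitone fun n => TwoSidedIdeal.span {s n} := antitone_nat_of_succ_le fun n =>
    span_singleton_le_iff_mem.2 (TwoSidedIdeal.mul_mem_left _ _ _ (hv _ (hs n)))
  refine ⟨Set.range s, ⟨0, rfl⟩, ?_, Set.disjoint_left.2 ?_⟩
  · rintro _ ⟨i, rfl⟩ _ ⟨j, rfl⟩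
    have hk := hs (max i j)
    exact ⟨_, hanti (le_max_left i j) (hu _ hk), _, hanti (le_max_right i j) (hv _ hk),
      max i j + 1, rfl⟩
  · rintro _ hn ⟨n, rfl⟩
    exact hs n hn

theorem mem_primeRadical {a : R} :
    a ∈ primeRadical R ↔ ∀ Q : TwoSidedIdeal R, Q.IsPrimeIdeal → a ∈ Q :=
  TwoSidedIdeal.mem_sInf R

theorem IsSemiprimeIdeal.primeRadical_le {T : TwoSidedIdeal R} (hT : IsSemiprimeIdeal T) :
    primeRadical R ≤ T := by
  intro a ha
  by_contra haT
  obtain ⟨S, haS, hS, hTS⟩ := hT.exists_isMSystem haT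
  obtain ⟨Q, hQ, -, hQS⟩ := hS.exists_isPrimeIdeal_disjoint ⟨a, haS⟩ hTS
  exact Set.disjoint_left.1 hQS (mem_primeRadical.1 ha Q hQ) haS

end PrimeIdeals

section PrimeRadical

variable {K R : Type*} [CommRing K] [NonUnitalRing R] [Module K R] [IsScalarTower K R R]
  [SMulCommClass K R R]

theorem smul_mem_of_isPrimeIdeal {Q : TwoSidedIdeal R} (hQ : Q.IsPrimeIdeal) (k : K) {a : R}
    (ha : a ∈ Q) : k • a ∈ Q := by
  have hN : IsAlgebraIdeal (Submodule.span K (Q : Set R)) := isAlgebraIdeal_span Q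
  have hmul : ∀ b ∈ Submodule.span K (Q : Set R), ∀ r : R, b * r ∈ Q := by
    intro _ hb
    induction hb using Submodule.span_induction with
    | mem x hx => exact fun r => Q.mul_mem_right _ _ hx
    | zero => exact fun r => by rw [zero_mul]; exact Q.zero_mem
    | add x y _ _ hx hy => exact fun r => by rw [add_mul]; exact Q.add_mem (hx r) (hy r)
    | smul k x _ hx => exact fun r => by rw [smul_mul_assoc, ← mul_smul_comm]; exact hx (k • r)
  rcases hQ.2 hN.toTwoSidedIdeal ⊤ (fun b hb r _ => hmul b (hN.mem_toTwoSidedIdeal.1 hb) r)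
    with hle | htop
  · exact hle (hN.mem_toTwoSidedIdeal.2 (Submodule.smul_mem _ k (Submodule.subset_span ha)))
  · exact absurd (top_le_iff.1 htop) hQ.1

variable (K R) in
/-- The prime radical as a `K`-submodule. -/
def primeRadicalSubmodule : Submodule K R where
  carrier := primeRadical R
  add_mem' := (primeRadical R).add_mem
  zero_mem' := (primeRadical R).zero_mem
  smul_mem' k _ ha := mem_primeRadical.2 fun Q hQ =>
    smul_mem_of_isPrimeIdeal hQ k (mem_primeRadical.1 ha Q hQ)

theorem isAlgebraIdeal_primeRadicalSubmodule : IsAlgebraIdeal (primeRadicalSubmodule K R) :=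
  ⟨fun _ _ ha => (primeRadical R).mul_mem_left _ _ ha,
    fun _ ha _ => (primeRadical R).mul_mem_right _ _ ha⟩

theorem IsNilpotentMod.le_of_isPrimeIdeal {N T : Submodule K R} (h : IsNilpotentMod N T)
    (hN : IsAlgebraIdeal N) {Q : TwoSidedIdeal R} (hQ : Q.IsPrimeIdeal)
    (hTQ : ∀ a ∈ T, a ∈ Q) : ∀ a ∈ N, a ∈ Q := by
  obtain ⟨n, hn⟩ := h
  have hpow : ∀ a ∈ leftPow N n, a ∈ Q := fun a ha => hTQ a (hn ha)
  clear hn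
  induction n with
  | zero => exact fun a _ => hpow a trivial
  | succ n ih =>
    rcases hQ.2 hN.toTwoSidedIdeal (hN.leftPow n).toTwoSidedIdeal (fun a ha b hb =>
      hpow _ (mul_mem_leftPow (hN.mem_toTwoSidedIdeal.1 ha)
        ((hN.leftPow n).mem_toTwoSidedIdeal.1 hb))) with hle | hle
    · exact fun a ha => hle (hN.mem_toTwoSidedIdeal.2 ha)
    · exact ih fun a ha => hle ((hN.leftPow n).mem_toTwoSidedIdeal.2 ha)

theorem nilSum_le_primeRadicalSubmodule {T : Submodule K R} (hT : T ≤ primeRadicalSubmodule K R) :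
    nilSum T ≤ primeRadicalSubmodule K R :=
  sSup_le fun _ ⟨hN, hNT⟩ a ha => mem_primeRadical.2 fun Q hQ =>
    hNT.le_of_isPrimeIdeal hN hQ (fun _ hb => mem_primeRadical.1 (hT hb) Q hQ) a ha

theorem isSemiprimeIdeal_of_nilSum_le {T : Submodule K R} (hT : IsAlgebraIdeal T)
    (hle : nilSum T ≤ T) : IsSemiprimeIdeal hT.toTwoSidedIdeal := by
  intro A hA _ ha
  let N : Submodule K R := Submodule.span K (A : Set R)
  have hN : IsAlgebraIdeal N := isAlgebraIdeal_span A
  have hNN : Submodule.map₂ (LinearMap.mul K R) N N ≤ T := by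
    rw [Submodule.map₂_span_span, Submodule.span_le]
    rintro _ ⟨b, hb, c, hc, rfl⟩
    exact hT.mem_toTwoSidedIdeal.1 (hA b hb c hc)
  have hN1 : leftPow N 1 ≤ N := leftPow_succ_le.2 fun b hb c _ => hN.mul_mem_right b hb c
  have hN2 : leftPow N 2 ≤ T := (Submodule.map₂_le_map₂_right hN1).trans hNN
  exact hT.mem_toTwoSidedIdeal.2 (hle (le_nilSum hN ⟨2, hN2⟩ (Submodule.subset_span ha)))

theorem primeRadicalSubmodule_le_of_nilSum_le {T : Submodule K R} (hT : IsAlgebraIdeal T)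
    (hle : nilSum T ≤ T) : primeRadicalSubmodule K R ≤ T :=
  fun _ ha => hT.mem_toTwoSidedIdeal.1 ((isSemiprimeIdeal_of_nilSum_le hT hle).primeRadical_le ha)

theorem primeRadicalSubmodule_induction {C : Submodule K R → Prop} (bot : C ⊥)
    (nilSum : ∀ T, IsAlgebraIdeal T → C T → C (nilSum T))
    (sSup : ∀ c : Set (Submodule K R), IsChain (· ≤ ·) c → c.Nonempty → (∀ T ∈ c, C T) →
      C (sSup c)) : C (primeRadicalSubmodule K R) := by
  obtain ⟨T, -, hT⟩ := zorn_le_nonempty₀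
    {T : Submodule K R | IsAlgebraIdeal T ∧ T ≤ primeRadicalSubmodule K R ∧ C T}
    (fun c hcC hc T hT => ⟨_, ⟨.sSup fun N hN => (hcC hN).1, sSup_le fun N hN => (hcC hN).2.1,
      sSup c hc ⟨T, hT⟩ fun N hN => (hcC hN).2.2⟩, fun N hN => le_sSup hN⟩)
    ⊥ ⟨isAlgebraIdeal_bot, bot_le, bot⟩
  obtain ⟨hTI, hTP, hTC⟩ := hT.prop
  have hle : _root_.nilSum T ≤ T :=
    hT.le_of_ge ⟨isAlgebraIdeal_nilSum T, nilSum_le_primeRadicalSubmodule hTP, nilSum T hTI hTC⟩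
      hTI.le_nilSum_self
  rwa [← hTP.antisymm (primeRadicalSubmodule_le_of_nilSum_le hTI hle)]

end PrimeRadical

section Homomorphisms

variable {K R S : Type*} [CommRing K] [NonUnitalRing R] [Module K R] [NonUnitalRing S]
  [Module K S] {f : R →ₙₐ[K] S}

theorem IsAlgebraIdeal.map {N : Submodule K R} (hN : IsAlgebraIdeal N)
    (hf : Function.Surjective f) : IsAlgebraIdeal (N.map (f : R →ₗ[K] S)) where
  mul_mem_left s := by
    rintro _ ⟨a, ha, rfl⟩
    obtain ⟨r, rfl⟩ := hf s
    exact ⟨r * a, hN.mul_mem_left r a ha, map_mul f r a⟩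
  mul_mem_right := by
    rintro _ ⟨a, ha, rfl⟩ s
    obtain ⟨r, rfl⟩ := hf s
    exact ⟨a * r, hN.mul_mem_right a ha r, map_mul f a r⟩

variable [IsScalarTower K R R] [SMulCommClass K R R] [IsScalarTower K S S] [SMulCommClass K S S]

theorem leftPow_map_le (hf : Function.Surjective f) (N : Submodule K R) (n : ℕ) :
    leftPow (N.map (f : R →ₗ[K] S)) n ≤ (leftPow N n).map (f : R →ₗ[K] S) := by
  induction n with
  | zero => exact fun s _ => (hf s).imp fun r hr => ⟨trivial, hr⟩
  | succ n ih =>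
    refine leftPow_succ_le.2 ?_
    rintro _ ⟨a, ha, rfl⟩ c hc
    obtain ⟨b, hb, rfl⟩ := ih hc
    exact ⟨a * b, mul_mem_leftPow ha hb, map_mul f a b⟩

theorem map_nilSum_le (hf : Function.Surjective f) (T : Submodule K R) :
    (nilSum T).map (f : R →ₗ[K] S) ≤ nilSum (T.map (f : R →ₗ[K] S)) :=
  Submodule.map_le_iff_le_comap.2 <| sSup_le fun N ⟨hN, n, hn⟩ =>
    Submodule.map_le_iff_le_comap.1 <| le_nilSum (hN.map hf)
      ⟨n, (leftPow_map_le hf N n).trans (Submodule.map_mono hn)⟩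

end Homomorphisms

section Automorphisms

variable {K R : Type*} [CommRing K] [NonUnitalRing R] [Module K R]

/-- The group of all `K`-linear ring automorphisms of `R` that map `T` onto itself. -/
def linearStabilizer (T : Submodule K R) : Subgroup (RingAut R) where
  carrier := {g | (∀ (k : K) (r : R), g (k • r) = k • g r) ∧ ∀ r, g r ∈ T ↔ r ∈ T}
  one_mem' := ⟨fun _ _ => rfl, fun _ => Iff.rfl⟩
  mul_mem' {g h} hg hh :=
    ⟨fun k r => by rw [RingAut.mul_apply, RingAut.mul_apply, hh.1, hg.1],
      fun r => by rw [RingAut.mul_apply, hg.2, hh.2]⟩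
  inv_mem' {g} hg :=
    ⟨fun k r => (g.symm_apply_eq).2 (by rw [hg.1]; exact congrArg _ (g.apply_symm_apply r).symm),
      fun r => (hg.2 _).symm.trans (iff_of_eq (congrArg (· ∈ T) (g.apply_symm_apply r)))⟩

theorem mem_linearStabilizer {T : Submodule K R} {g : RingAut R} :
    g ∈ linearStabilizer T ↔
      (∀ (k : K) (r : R), g (k • r) = k • g r) ∧ ∀ r, g r ∈ T ↔ r ∈ T :=
  Iff.rfl

/-- The span of the translates of `V` under the group `H`. -/
def orbitSpan (H : Subgroup (RingAut R)) (V : Submodule K R) : Submodule K R :=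
  Submodule.span K {r : R | ∃ g ∈ H, ∃ v ∈ V, r = g v}

theorem apply_mem_orbitSpan {H : Subgroup (RingAut R)} {V : Submodule K R} {g : RingAut R}
    (hg : g ∈ H) {v : R} (hv : v ∈ V) : g v ∈ orbitSpan H V :=
  Submodule.subset_span ⟨g, hg, v, hv, rfl⟩

theorem le_orbitSpan (H : Subgroup (RingAut R)) (V : Submodule K R) : V ≤ orbitSpan H V :=
  fun _ hv => apply_mem_orbitSpan H.one_mem hv

theorem orbitSpan_le {H : Subgroup (RingAut R)} {V W : Submodule K R}
    (hH : H ≤ linearStabilizer W) (hV : V ≤ W) : orbitSpan H V ≤ W := by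
  refine Submodule.span_le.2 ?_
  rintro _ ⟨g, hg, v, hv, rfl⟩
  exact ((hH hg).2 v).2 (hV hv)

theorem map_orbitSpan_le {H : Subgroup (RingAut R)} {V : Submodule K R} {g : RingAut R}
    (hg : g ∈ H) (hgK : ∀ (k : K) (r : R), g (k • r) = k • g r) {r : R}
    (hr : r ∈ orbitSpan H V) : g r ∈ orbitSpan H V := by
  induction hr using Submodule.span_induction with
  | mem x hx =>
    obtain ⟨h, hh, v, hv, rfl⟩ := hx
    exact apply_mem_orbitSpan (H.mul_mem hg hh) hv
  | zero => rw [map_zero]; exact zero_mem _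
  | add x y _ _ hx hy => rw [map_add]; exact add_mem hx hy
  | smul k x _ hx => rw [hgK]; exact Submodule.smul_mem _ _ hx

/-- The largest submodule of `N` that is stable under `H`. Scalars occur in the condition so that
it defines a submodule although the members of `H` need not be `K`-linear. -/
def stableCore (H : Subgroup (RingAut R)) (N : Submodule K R) : Submodule K R where
  carrier := {r | ∀ h ∈ H, ∀ k : K, h (k • r) ∈ N}
  add_mem' hx hy h hh k := by rw [smul_add, map_add]; exact add_mem (hx h hh k) (hy h hh k)
  zero_mem' h _ k := by rw [smul_zero, map_zero]; exact zero_mem _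
  smul_mem' k x hx h hh l := by rw [smul_smul]; exact hx h hh (l * k)

theorem stableCore_le (H : Subgroup (RingAut R)) (N : Submodule K R) : stableCore H N ≤ N :=
  fun r hr => by simpa only [one_smul, RingAut.one_apply] using hr 1 H.one_mem 1

theorem le_stableCore {H : Subgroup (RingAut R)} {N V : Submodule K R} (h : orbitSpan H V ≤ N) :
    V ≤ stableCore H N :=
  fun _ hv _ hg k => h (apply_mem_orbitSpan hg (V.smul_mem k hv))

theorem mem_linearStabilizer_stableCore {H : Subgroup (RingAut R)} {g : RingAut R} (hg : g ∈ H)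
    (hgK : ∀ (k : K) (r : R), g (k • r) = k • g r) (N : Submodule K R) :
    g ∈ linearStabilizer (stableCore H N) := by
  refine ⟨hgK, fun r => ⟨fun hr h hh k => ?_, fun hr h hh k => ?_⟩⟩
  · have hmem : h (g.symm (k • g r)) ∈ N := hr (h * g⁻¹) (mul_mem hh (inv_mem hg)) k
    rwa [← hgK, g.symm_apply_apply] at hmem
  · rw [← hgK]
    exact hr (h * g) (mul_mem hh hg) k

variable [IsScalarTower K R R] [SMulCommClass K R R]

theorem IsAlgebraIdeal.stableCore {N : Submodule K R} (hN : IsAlgebraIdeal N)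
    (H : Subgroup (RingAut R)) : IsAlgebraIdeal (stableCore H N) where
  mul_mem_left r a ha h hh k := by
    rw [← mul_smul_comm, map_mul]
    exact hN.mul_mem_left _ _ (ha h hh k)
  mul_mem_right a ha r h hh k := by
    rw [← smul_mul_assoc, map_mul]
    exact hN.mul_mem_right _ (ha h hh k) _

theorem linearStabilizer_le_nilSum (T : Submodule K R) :
    linearStabilizer T ≤ linearStabilizer (nilSum T) := by
  have hmaps : ∀ g ∈ linearStabilizer T, ∀ a ∈ nilSum T, g a ∈ nilSum T := fun g hg a ha => by
    let f : R →ₙₐ[K] R :=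
      { toFun := g, map_smul' := hg.1, map_zero' := map_zero g, map_add' := map_add g,
        map_mul' := map_mul g }
    have hT : T.map (f : R →ₗ[K] R) ≤ T := Submodule.map_le_iff_le_comap.2 fun r => (hg.2 r).2
    exact nilSum_mono hT (map_nilSum_le (f := f) g.surjective T ⟨a, ha, rfl⟩)
  refine fun g hg => ⟨hg.1, fun r => ⟨fun hr => ?_, hmaps g hg r⟩⟩
  have hmem : g.symm (g r) ∈ nilSum T := hmaps g⁻¹ (inv_mem hg) _ hr
  rwa [g.symm_apply_apply] at hmem

end Automorphisms

section Derivations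

variable {K R : Type*} [CommRing K] [NonUnitalRing R] [Module K R]

/-- The Leibniz rule of a skew derivation, for an endomorphism of the `K`-module `R`; this is the
linear counterpart of `SkewDerivation`, so that powers and images of submodules make sense. -/
def IsSkewDerivation (g : RingAut R) (D : Module.End K R) : Prop :=
  ∀ a b : R, D (a * b) = D a * b + g a * D b

/-- The elements `b` with `b, D b, …, D ^ (m - 1) b ∈ N`. -/
def derivLayer (N : Submodule K R) (D : Module.End K R) : ℕ → Submodule K R
  | 0 => ⊤
  | m + 1 => N ⊓ (derivLayer N D m).comap D

variable {N T : Submodule K R} {D : Module.End K R} {g : RingAut R} {q : K}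

theorem derivLayer_succ_le (N : Submodule K R) (D : Module.End K R) (m : ℕ) :
    derivLayer N D (m + 1) ≤ derivLayer N D m := by
  induction m with
  | zero => exact le_top
  | succ m ih => exact fun b hb => ⟨hb.1, ih hb.2⟩

theorem pow_apply_mem_of_mem_derivLayer {m : ℕ} {b : R} (hb : b ∈ derivLayer N D (m + 1)) :
    (D ^ m) b ∈ N := by
  induction m generalizing b with
  | zero => exact hb.1
  | succ m ih => rw [pow_succ]; exact ih hb.2

theorem mul_mem_derivLayer (hN : IsAlgebraIdeal N) (hD : IsSkewDerivation g D) {m : ℕ} (r : R)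
    {b : R} (hb : b ∈ derivLayer N D m) : r * b ∈ derivLayer N D m := by
  induction m generalizing r b with
  | zero => trivial
  | succ m ih =>
    refine ⟨hN.mul_mem_left r b hb.1, ?_⟩
    rw [SetLike.mem_coe, Submodule.mem_comap, hD]
    exact add_mem (ih _ (derivLayer_succ_le N D m hb)) (ih _ hb.2)

theorem mul_mem_derivLayer_succ (hN : IsAlgebraIdeal N) (hNg : ∀ a ∈ N, g a ∈ N)
    (hD : IsSkewDerivation g D) {m : ℕ} {a b : R} (ha : a ∈ N) (hb : b ∈ derivLayer N D m) :
    a * b ∈ derivLayer N D (m + 1) := by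
  induction m generalizing a b with
  | zero => exact ⟨hN.mul_mem_right a ha b, trivial⟩
  | succ m ih =>
    refine ⟨hN.mul_mem_right a ha b, ?_⟩
    rw [SetLike.mem_coe, Submodule.mem_comap, hD]
    exact add_mem (mul_mem_derivLayer hN hD _ hb) (ih (hNg a ha) hb.2)

theorem pow_apply_mul_sub_mem (hN : IsAlgebraIdeal N) (hD : IsSkewDerivation g D) {m : ℕ} (r : R)
    {b : R} (hb : b ∈ derivLayer N D m) : (D ^ m) (r * b) - (g ^ m) r * (D ^ m) b ∈ N := by
  induction m generalizing r b with
  | zero =>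
    rw [pow_zero, pow_zero, Module.End.one_apply, Module.End.one_apply, RingAut.one_apply, sub_self]
    exact zero_mem N
  | succ m ih =>
    have hsplit : (D ^ (m + 1)) (r * b) - (g ^ (m + 1)) r * (D ^ (m + 1)) b =
        (D ^ m) (D r * b) + ((D ^ m) (g r * D b) - (g ^ m) (g r) * (D ^ m) (D b)) := by
      rw [pow_succ, pow_succ, Module.End.mul_apply, Module.End.mul_apply, RingAut.mul_apply, hD,
        map_add, add_sub_assoc]
    rw [hsplit]
    exact add_mem (pow_apply_mem_of_mem_derivLayer (mul_mem_derivLayer hN hD (D r) hb))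
      (ih (g r) hb.2)

theorem pow_map_smul (hgK : ∀ (k : K) (r : R), g (k • r) = k • g r) (m : ℕ) (k : K) (r : R) :
    (g ^ m) (k • r) = k • (g ^ m) r :=
  (pow_mem (mem_linearStabilizer.2 ⟨hgK, fun _ => Iff.rfl⟩ :
    g ∈ linearStabilizer (⊤ : Submodule K R)) m).1 k r

theorem apply_pow_apply (hgK : ∀ (k : K) (r : R), g (k • r) = k • g r)
    (hq : ∀ r, D (g r) = q • g (D r)) (m : ℕ) (r : R) :
    D ((g ^ m) r) = q ^ m • (g ^ m) (D r) := by
  induction m generalizing r with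
  | zero => rw [pow_zero, pow_zero, one_smul, RingAut.one_apply, RingAut.one_apply]
  | succ m ih =>
    rw [pow_succ g, RingAut.mul_apply, RingAut.mul_apply, ih, hq, pow_map_smul hgK, smul_smul,
      pow_succ]

theorem IsAlgebraIdeal.map_sup (hN : IsAlgebraIdeal N) (hNg : ∀ a ∈ N, g a ∈ N)
    (hD : IsSkewDerivation g D) : IsAlgebraIdeal (N.map D ⊔ N) where
  mul_mem_left r x hx := by
    obtain ⟨_, ⟨a, ha, rfl⟩, b, hb, rfl⟩ := Submodule.mem_sup.1 hx
    obtain ⟨r, rfl⟩ := g.surjective r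
    rw [mul_add, show g r * D a = D (r * a) - D r * a from eq_sub_of_add_eq' (hD r a).symm]
    exact add_mem (sub_mem (Submodule.mem_sup_left ⟨_, hN.mul_mem_left r a ha, rfl⟩)
      (Submodule.mem_sup_right (hN.mul_mem_left _ a ha)))
      (Submodule.mem_sup_right (hN.mul_mem_left _ b hb))
  mul_mem_right x hx r := by
    obtain ⟨_, ⟨a, ha, rfl⟩, b, hb, rfl⟩ := Submodule.mem_sup.1 hx
    rw [add_mul, show D a * r = D (a * r) - g a * D r from eq_sub_of_add_eq (hD a r).symm]
    exact add_mem (sub_mem (Submodule.mem_sup_left ⟨_, hN.mul_mem_right a ha r, rfl⟩)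
      (Submodule.mem_sup_right (hN.mul_mem_right _ (hNg a ha) _)))
      (Submodule.mem_sup_right (hN.mul_mem_right b hb r))

/-- All other terms in the iterated Leibniz rule for `D ^ (m + 1) (a * b)` lie in `N`. -/
theorem pow_succ_apply_mul_sub_mem [IsScalarTower K R R] (hN : IsAlgebraIdeal N)
    (hNg : ∀ a ∈ N, g a ∈ N) (hgK : ∀ (k : K) (r : R), g (k • r) = k • g r)
    (hD : IsSkewDerivation g D) (hq : ∀ r, D (g r) = q • g (D r))
    {m : ℕ} {a b : R} (ha : a ∈ N) (hb : b ∈ derivLayer N D m) :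
    (D ^ (m + 1)) (a * b) -
      (∑ i ∈ Finset.range (m + 1), q ^ i) • ((g ^ m) (D a) * (D ^ m) b) ∈ N := by
  induction m generalizing a b with
  | zero =>
    rw [zero_add, Finset.sum_range_one, pow_one, pow_zero, pow_zero, pow_zero, one_smul,
      RingAut.one_apply, Module.End.one_apply, hD, add_sub_cancel_left]
    exact hN.mul_mem_right _ (hNg a ha) _
  | succ m ih =>
    have hleft := pow_apply_mul_sub_mem hN hD (D a) hb
    have hright := ih (hNg a ha) hb.2
    have hsplit : (D ^ (m + 1 + 1)) (a * b) =
        (D ^ (m + 1)) (D a * b) + (D ^ (m + 1)) (g a * D b) := by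
      rw [pow_succ, Module.End.mul_apply, hD, map_add]
    have htwist : (g ^ m) (D (g a)) * (D ^ m) (D b) =
        q • ((g ^ (m + 1)) (D a) * (D ^ (m + 1)) b) := by
      rw [hq, pow_map_smul hgK, smul_mul_assoc]
      rfl
    rw [htwist, smul_smul] at hright
    rw [hsplit, geom_sum_succ, add_smul, one_smul, mul_comm q]
    convert add_mem hleft hright using 1
    abel

variable [IsScalarTower K R R] [SMulCommClass K R R]

theorem leftPow_le_derivLayer (hN : IsAlgebraIdeal N) (hNg : ∀ a ∈ N, g a ∈ N)
    (hD : IsSkewDerivation g D) (m : ℕ) : leftPow N m ≤ derivLayer N D m := by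
  induction m with
  | zero => exact le_rfl
  | succ m ih =>
    exact leftPow_succ_le.2 fun a ha b hb => mul_mem_derivLayer_succ hN hNg hD ha (ih hb)

theorem IsSkewDerivation.leftPow_map_le (hD : IsSkewDerivation g D) (hN : IsAlgebraIdeal N)
    (hgN : g ∈ linearStabilizer N) (hq : ∀ r, D (g r) = q • g (D r))
    (hq_sum : ∀ n : ℕ, IsUnit (∑ i ∈ Finset.range (n + 1), q ^ i)) (n : ℕ) :
    leftPow (N.map D) n ≤ (leftPow N n).map (D ^ n) ⊔ N := by
  have hNg : ∀ a ∈ N, g a ∈ N := fun a => (hgN.2 a).2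
  induction n with
  | zero => exact fun r _ => Submodule.mem_sup_left ⟨r, trivial, rfl⟩
  | succ n ih =>
    refine leftPow_succ_le.2 ?_
    rintro _ ⟨a, ha, rfl⟩ c hc
    obtain ⟨_, ⟨b, hb, rfl⟩, d, hd, rfl⟩ := Submodule.mem_sup.1 (ih hc)
    rw [mul_add]
    refine add_mem ?_ (Submodule.mem_sup_right (hN.mul_mem_left _ d hd))
    obtain ⟨a', rfl⟩ := (g ^ n).surjective a
    have ha' : a' ∈ N := ((pow_mem hgN n).2 a').1 ha
    have hleibniz := pow_succ_apply_mul_sub_mem hN hNg hgN.1 hD hq ha'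
      (leftPow_le_derivLayer hN hNg hD n hb)
    have hmem : (∑ i ∈ Finset.range (n + 1), q ^ i) • ((g ^ n) (D a') * (D ^ n) b) ∈
        (leftPow N (n + 1)).map (D ^ (n + 1)) ⊔ N := by
      rw [← sub_sub_cancel ((D ^ (n + 1)) (a' * b))
        ((∑ i ∈ Finset.range (n + 1), q ^ i) • ((g ^ n) (D a') * (D ^ n) b))]
      exact sub_mem (Submodule.mem_sup_left ⟨_, mul_mem_leftPow ha' hb, rfl⟩)
        (Submodule.mem_sup_right hleibniz)
    rw [apply_pow_apply hgN.1 hq, smul_mul_assoc]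
    exact Submodule.smul_mem _ _ ((Submodule.smul_mem_iff_of_isUnit _ (hq_sum n)).1 hmem)

theorem IsNilpotentMod.map_sup (hN : IsAlgebraIdeal N) (hT : IsAlgebraIdeal T)
    (hgN : g ∈ linearStabilizer N) (hTD : ∀ a ∈ T, D a ∈ T)
    (hD : IsSkewDerivation g D) (hq : ∀ r, D (g r) = q • g (D r))
    (hq_sum : ∀ n : ℕ, IsUnit (∑ i ∈ Finset.range (n + 1), q ^ i))
    (h : IsNilpotentMod N T) : IsNilpotentMod (N.map D ⊔ N) T := by
  refine IsNilpotentMod.sup hT hN (h.imp fun n hn => ?_) h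
  have hTDn : ∀ a ∈ T, (D ^ n) a ∈ T := fun a ha =>
    Module.End.pow_apply_mem_of_forall_mem n hTD a ha
  refine (hD.leftPow_map_le hN hgN hq hq_sum n).trans (sup_le ?_ le_sup_left)
  exact (Submodule.map_le_iff_le_comap.2 fun a ha => hTDn a (hn ha)).trans le_sup_right

theorem IsSkewDerivation.apply_mem_nilSum (hD : IsSkewDerivation g D) (hT : IsAlgebraIdeal T)
    (hgT : g ∈ linearStabilizer T) (hTD : ∀ a ∈ T, D a ∈ T)
    (hq : ∀ r, D (g r) = q • g (D r))
    (hq_sum : ∀ n : ℕ, IsUnit (∑ i ∈ Finset.range (n + 1), q ^ i))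
    (hfg : ∀ V : Submodule K R, V.FG → (orbitSpan (Subgroup.closure {g}) V).FG)
    {a : R} (ha : a ∈ nilSum T) : D a ∈ nilSum T := by
  let H : Subgroup (RingAut R) := Subgroup.closure {g}
  have hgH : g ∈ H := Subgroup.subset_closure rfl
  have hHT : H ≤ linearStabilizer T := (Subgroup.closure_le _).2 (Set.singleton_subset_iff.2 hgT)
  obtain ⟨N, hN, hNT, horbit⟩ := exists_isNilpotentMod_of_fg_le_nilSum hT
    (hfg _ (Submodule.fg_span_singleton a))
    (orbitSpan_le (hHT.trans (linearStabilizer_le_nilSum T))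
      ((Submodule.span_singleton_le_iff_mem ..).2 ha))
  have hcore : IsAlgebraIdeal (stableCore H N) := hN.stableCore H
  have hgcore : g ∈ linearStabilizer (stableCore H N) :=
    mem_linearStabilizer_stableCore hgH hgT.1 N
  have hacore : a ∈ stableCore H N := le_stableCore horbit (Submodule.mem_span_singleton_self a)
  exact le_nilSum (hcore.map_sup (fun b => (hgcore.2 b).2) hD)
    ((hNT.mono (stableCore_le H N)).map_sup hcore hT hgcore hTD hD hq hq_sum)
    (Submodule.mem_sup_left ⟨a, hacore, rfl⟩)

end Derivations

section ProductSets

open scoped Pointwise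

variable {A B : Type*} [NonUnitalRing A] [NonUnitalRing B]

/-- The set of all products of `n + 1` elements of `s`. -/
def iterProd (s : Set A) : ℕ → Set A
  | 0 => s
  | n + 1 => s * iterProd s n

theorem iterProd_add_one_add (s : Set A) (n k : ℕ) :
    iterProd s (n + 1 + k) = iterProd s n * iterProd s k := by
  induction n with
  | zero => rw [zero_add, add_comm]; rfl
  | succ n ih => rw [add_right_comm (n + 1), iterProd, ih, ← mul_assoc]; rfl

theorem iterProd_iterProd (s : Set A) (n m : ℕ) :
    iterProd (iterProd s n) m = iterProd s ((n + 1) * m + n) := by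
  induction m with
  | zero => rw [mul_zero, zero_add]; rfl
  | succ m ih =>
    rw [show (n + 1) * (m + 1) + n = n + 1 + ((n + 1) * m + n) by ring, iterProd_add_one_add, ← ih]
    rfl

theorem finite_iterProd {s : Set A} (hs : s.Finite) (n : ℕ) : (iterProd s n).Finite := by
  induction n with
  | zero => exact hs
  | succ n ih => exact hs.mul ih

theorem image_iterProd (f : A →ₙ* B) (s : Set A) (n : ℕ) :
    f '' iterProd s n = iterProd (f '' s) n := by
  induction n with
  | zero => rfl
  | succ n ih => rw [iterProd, Set.image_mul, ih]; rfl

theorem iterProd_add_subset_zero {s : Set A} {n : ℕ} (h : iterProd s n ⊆ {0}) (m : ℕ) :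
    iterProd s (n + m) ⊆ {0} := by
  cases m with
  | zero => exact h
  | succ m =>
    rw [add_comm m, ← add_assoc, iterProd_add_one_add]
    rintro _ ⟨a, ha, b, -, rfl⟩
    exact (congrArg (· * b) (h ha)).trans (zero_mul b)

/-- The additive group generated by all products of more than `n` elements of `s`. -/
def productSpan (s : Set A) (n : ℕ) : AddSubgroup A :=
  AddSubgroup.closure (⋃ m, iterProd s (n + m))

theorem productSpan_antitone (s : Set A) : Antitone (productSpan s) := by
  refine antitone_nat_of_succ_le fun n => AddSubgroup.closure_mono (Set.iUnion_subset fun m => ?_)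
  rw [add_assoc]
  exact Set.subset_iUnion (fun m => iterProd s (n + m)) (1 + m)

theorem productSpan_eq_bot {s : Set A} {n : ℕ} (h : iterProd s n ⊆ {0}) : productSpan s n = ⊥ :=
  AddSubgroup.closure_eq_bot_iff.2 (Set.iUnion_subset (iterProd_add_subset_zero h))

theorem mul_mem_productSpan {s : Set A} {n k : ℕ} {a b : A} (ha : a ∈ productSpan s n)
    (hb : b ∈ productSpan s k) : a * b ∈ productSpan s (n + 1 + k) := by
  refine (AddSubgroup.closure_le ((productSpan s (n + 1 + k)).comap (.mulRight b))).2
    (Set.iUnion_subset fun i x hx => ?_) ha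
  refine (AddSubgroup.closure_le ((productSpan s (n + 1 + k)).comap (.mulLeft x))).2
    (Set.iUnion_subset fun j y hy => ?_) hb
  refine AddSubgroup.subset_closure (Set.mem_iUnion.2 ⟨i + j, ?_⟩)
  rw [show n + 1 + k + (i + j) = n + i + 1 + (k + j) by omega, iterProd_add_one_add]
  exact Set.mul_mem_mul hx hy

theorem mem_productSpan_of_mem_closure {s : Set A} {a : A} (ha : a ∈ NonUnitalSubring.closure s) :
    a ∈ productSpan s 0 := by
  induction ha using NonUnitalSubring.closure_induction with
  | mem x hx => exact AddSubgroup.subset_closure (Set.mem_iUnion.2 ⟨0, hx⟩)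
  | zero => exact zero_mem _
  | add x y _ _ hx hy => exact add_mem hx hy
  | neg x _ hx => exact neg_mem hx
  | mul x y _ _ hx hy => exact productSpan_antitone s (Nat.zero_le _) (mul_mem_productSpan hx hy)

theorem foldl_mem_productSpan {s : Set A} (l : List (NonUnitalSubring.closure s))
    {a : NonUnitalSubring.closure s} {n : ℕ} (ha : (a : A) ∈ productSpan s n) :
    ((l.foldl (· * ·) a : NonUnitalSubring.closure s) : A) ∈ productSpan s (n + l.length) := by
  induction l generalizing a n with
  | nil => exact ha
  | cons b l ih =>
    have hab := mul_mem_productSpan ha (mem_productSpan_of_mem_closure b.2)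
    rw [List.length_cons, add_comm l.length, ← add_assoc]
    exact ih (a := a * b) (by rwa [add_zero, ← MulMemClass.coe_mul] at hab)

theorem isNilpotentRing_closure {s : Set A} {n : ℕ} (h : iterProd s n ⊆ {0}) :
    IsNilpotentRing (NonUnitalSubring.closure s) := by
  refine ⟨n, fun a l hl => Subtype.ext ?_⟩
  have hmem := foldl_mem_productSpan l (mem_productSpan_of_mem_closure a.2)
  rwa [zero_add, hl, productSpan_eq_bot h, AddSubgroup.mem_bot] at hmem

theorem isLocallyNilpotentRing_of_iterProd_subset {J : TwoSidedIdeal A}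
    (h : ∀ s : Set A, s.Finite → s ⊆ J → ∃ n, iterProd s n ⊆ {0}) : IsLocallyNilpotentRing J := by
  intro s
  let f : J →ₙ* A := ⟨Subtype.val, fun _ _ => rfl⟩
  obtain ⟨n, hn⟩ := h (f '' s) (s.finite_toSet.image f) (by rintro _ ⟨a, -, rfl⟩; exact a.2)
  rw [← image_iterProd] at hn
  exact isNilpotentRing_closure fun a ha => Subtype.ext (hn ⟨a, ha, rfl⟩)

end ProductSets

section Coefficients

variable {K R X : Type*} [CommRing K] [NonUnitalRing R] [Module K R]
  {σ : X → RingAut R} {δ : ∀ x, SkewDerivation (σ x)} {E E' : Submodule K R}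

/-- The polynomials all of whose coefficients lie in the submodule `E`; this is `polynomialsOver`
for submodules instead of ideals. -/
def coeffsIn (σ : X → RingAut R) (δ : ∀ x, SkewDerivation (σ x)) (E : Submodule K R) :
    AddSubgroup (FreeSkewExtension σ δ) where
  carrier := {f | ∀ w, f.coeff w ∈ E}
  add_mem' hf hg w := add_mem (hf w) (hg w)
  zero_mem' _ := zero_mem E
  neg_mem' hf w := neg_mem (hf w)

theorem single_mem_coeffsIn (w : FreeMonoid X) {r : R} (hr : r ∈ E) :
    (Finsupp.single w r : FreeMonoid X →₀ R) ∈ coeffsIn σ δ E := by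
  classical
  intro v
  change Finsupp.single w r v ∈ E
  rw [Finsupp.single_apply]
  split_ifs
  exacts [hr, zero_mem E]

theorem map_mem_coeffsIn {φ : AddMonoid.End (FreeMonoid X →₀ R)}
    (h : ∀ w, ∀ r ∈ E, φ (Finsupp.single w r) ∈ coeffsIn σ δ E') {f : FreeMonoid X →₀ R}
    (hf : f ∈ coeffsIn σ δ E) : φ f ∈ coeffsIn σ δ E' := by
  rw [← f.sum_single, Finsupp.sum, map_sum]
  exact AddSubgroup.sum_mem (coeffsIn σ δ E') fun w _ => h w _ (hf w)

theorem coeffMul_mem_coeffsIn {a : R} (h : ∀ r ∈ E, a * r ∈ E') {f : FreeMonoid X →₀ R}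
    (hf : f ∈ coeffsIn σ δ E) : FreeSkew.coeffMul a f ∈ coeffsIn σ δ E' := by
  refine map_mem_coeffsIn (fun w r hr => ?_) hf
  rw [FreeSkew.coeffMul_single]
  exact single_mem_coeffsIn w (h r hr)

theorem varMul_mem_coeffsIn {x : X} (hσ : ∀ r ∈ E, σ x r ∈ E') (hδ : ∀ r ∈ E, δ x r ∈ E')
    {f : FreeMonoid X →₀ R} (hf : f ∈ coeffsIn σ δ E) :
    FreeSkew.varMul σ δ x f ∈ coeffsIn σ δ E' := by
  refine map_mem_coeffsIn (fun w r hr => ?_) hf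
  rw [FreeSkew.varMul_single]
  exact AddSubgroup.add_mem (coeffsIn σ δ E') (single_mem_coeffsIn _ (hσ r hr))
    (single_mem_coeffsIn _ (hδ r hr))

theorem mul_mem_coeffsIn {f g : FreeSkewExtension σ δ}
    (h : ∀ w, f.coeff w ≠ 0 →
      FreeSkew.coeffMul (f.coeff w) (FreeMonoid.lift (FreeSkew.varMul σ δ) w g) ∈
        coeffsIn σ δ E) :
    f * g ∈ coeffsIn σ δ E := by
  let f' : FreeMonoid X →₀ R := f
  have hfg : f * g = ∑ w ∈ f'.support,
      (FreeSkew.coeffMul (f.coeff w) (FreeMonoid.lift (FreeSkew.varMul σ δ) w g) :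
        FreeSkewExtension σ δ) := by
    change FreeSkew.polyMul σ δ f' g = _
    rw [FreeSkew.polyMul, Finsupp.liftAddHom_apply, Finsupp.sum]
    exact AddMonoidHom.finsetSum_apply ..
  rw [hfg]
  exact sum_mem fun w hw => h w (Finsupp.mem_support_iff.1 hw)

/-- An increasing sequence of submodules that each `σ x` with `x ∈ S` preserves and along which
each `δ x` with `x ∈ S` raises the index by at most one. -/
structure IsStableFiltration (σ : X → RingAut R) (δ : ∀ x, SkewDerivation (σ x)) (S : Set X)
    (U : ℕ → Submodule K R) : Prop where
  mono : Monotone U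
  map_mem : ∀ x ∈ S, ∀ j, ∀ u ∈ U j, σ x u ∈ U j
  deriv_mem : ∀ x ∈ S, ∀ j, ∀ u ∈ U j, δ x u ∈ U (j + 1)

theorem IsStableFiltration.word_apply_mem_coeffsIn {S : Set X} {U : ℕ → Submodule K R}
    (hU : IsStableFiltration σ δ S U) (w : FreeMonoid X) (hw : ∀ x ∈ w.toList, x ∈ S) {c : ℕ}
    {f : FreeMonoid X →₀ R} (hf : f ∈ coeffsIn σ δ (U c)) :
    FreeMonoid.lift (FreeSkew.varMul σ δ) w f ∈ coeffsIn σ δ (U (c + w.length)) := by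
  induction w using FreeMonoid.inductionOn' with
  | one => exact hf
  | of_mul x w ih =>
    obtain ⟨hx, hw⟩ := List.forall_mem_cons.1 hw
    rw [map_mul, FreeMonoid.lift_eval_of, FreeSkew.end_mul_apply, FreeMonoid.length_mul,
      FreeMonoid.length_of, add_comm 1, ← add_assoc]
    exact varMul_mem_coeffsIn
      (fun r hr => hU.mono (Nat.le_succ _) (hU.map_mem x hx _ r hr)) (hU.deriv_mem x hx _) (ih hw)

/-- The submodule `T` is stable under all the maps `σ x` (both ways) and `δ x`. -/
structure IsSkewInvariant (σ : X → RingAut R) (δ : ∀ x, SkewDerivation (σ x)) (T : Submodule K R) :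
    Prop where
  mem_stabilizer : ∀ x, σ x ∈ linearStabilizer T
  deriv_mem : ∀ x, ∀ r ∈ T, δ x r ∈ T

theorem IsSkewInvariant.isStableFiltration {T : Submodule K R} (hT : IsSkewInvariant σ δ T) :
    IsStableFiltration σ δ Set.univ fun _ => T :=
  ⟨monotone_const, fun x _ _ u => ((hT.mem_stabilizer x).2 u).2,
    fun x _ _ => hT.deriv_mem x⟩

/-- The polynomials over an invariant algebra ideal, as a two-sided ideal. -/
def polynomialIdeal {T : Submodule K R} (hT : IsAlgebraIdeal T) (hinv : IsSkewInvariant σ δ T) :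
    TwoSidedIdeal (FreeSkewExtension σ δ) :=
  .mk' (coeffsIn σ δ T) (zero_mem _) add_mem neg_mem
    (fun {f _} hg => mul_mem_coeffsIn fun w _ =>
      coeffMul_mem_coeffsIn (hT.mul_mem_left (f.coeff w))
        (hinv.isStableFiltration.word_apply_mem_coeffsIn w (fun _ _ => trivial) (c := 0) hg))
    (fun {_ _} hf => mul_mem_coeffsIn fun w _ =>
      coeffMul_mem_coeffsIn (E := ⊤) (fun r _ => hT.mul_mem_right _ (hf w) r) (fun _ => trivial))

theorem mem_polynomialIdeal {T : Submodule K R} (hT : IsAlgebraIdeal T)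
    (hinv : IsSkewInvariant σ δ T) {f : FreeSkewExtension σ δ} :
    f ∈ polynomialIdeal hT hinv ↔ f ∈ coeffsIn σ δ T :=
  TwoSidedIdeal.mem_mk' ..

variable (K) in
/-- The `K`-span of all coefficients of the members of `s`. -/
def coeffSpan (s : Set (FreeSkewExtension σ δ)) : Submodule K R :=
  Submodule.span K {r | ∃ f ∈ s, ∃ w, f.coeff w = r}

theorem coeffSpan_le_iff {s : Set (FreeSkewExtension σ δ)} :
    coeffSpan K s ≤ E ↔ s ⊆ coeffsIn σ δ E := by
  refine Submodule.span_le.trans ⟨fun h f hf w => h ⟨f, hf, w, rfl⟩, ?_⟩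
  rintro h _ ⟨f, hf, w, rfl⟩
  exact h hf w

theorem fg_coeffSpan {s : Set (FreeSkewExtension σ δ)} (hs : s.Finite) : (coeffSpan K s).FG := by
  have hrange : ∀ f : FreeSkewExtension σ δ, (Set.range f.coeff).Finite :=
    fun f => Finsupp.finite_range (show FreeMonoid X →₀ R from f)
  refine Submodule.fg_span ((hs.biUnion fun f _ => hrange f).subset ?_)
  rintro _ ⟨f, hf, w, rfl⟩
  exact Set.mem_biUnion hf ⟨w, rfl⟩

theorem exists_letters_mem_length_le {s : Set (FreeSkewExtension σ δ)} (hs : s.Finite) :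
    ∃ (S : Finset X) (d : ℕ), ∀ f ∈ s, ∀ w, f.coeff w ≠ 0 →
      (∀ x ∈ w.toList, x ∈ S) ∧ w.length ≤ d := by
  classical
  let supp : FreeSkewExtension σ δ → Finset (FreeMonoid X) :=
    fun f => Finsupp.support (show FreeMonoid X →₀ R from f)
  let B : Finset (FreeMonoid X) := hs.toFinset.biUnion supp
  refine ⟨B.biUnion fun w => w.toList.toFinset, B.sup FreeMonoid.length, fun f hf w hw => ?_⟩
  have hB : w ∈ B :=
    Finset.mem_biUnion.2 ⟨f, hs.mem_toFinset.2 hf, Finsupp.mem_support_iff.2 hw⟩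
  exact ⟨fun x hx => Finset.mem_biUnion.2 ⟨w, hB, List.mem_toFinset.2 hx⟩,
    Finset.le_sup (f := FreeMonoid.length) hB⟩

end Coefficients

section Filtrations

variable {K R X : Type*} [CommRing K] [NonUnitalRing R] [Module K R]
  {σ : X → RingAut R} {δ : ∀ x, SkewDerivation (σ x)}

/-- A `K`-linear skew derivation as an endomorphism of the `K`-module `R`. -/
def SkewDerivation.toEnd {g : RingAut R} (d : SkewDerivation g)
    (hd : ∀ (k : K) (r : R), d (k • r) = k • d r) : Module.End K R :=
  { toFun := d, map_add' := map_add d.toAddMonoidHom, map_smul' := hd }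

theorem SkewDerivation.isSkewDerivation_toEnd {g : RingAut R} (d : SkewDerivation g)
    (hd : ∀ (k : K) (r : R), d (k • r) = k • d r) : IsSkewDerivation g (d.toEnd hd) :=
  d.leibniz

/-- The span of the products `u₁ u₂ ⋯ uₙ r` with `uᵢ ∈ U jᵢ`, `∑ jᵢ = c` and `r ∈ R`. -/
def weightedProd (U : ℕ → Submodule K R) : ℕ → ℕ → Submodule K R
  | 0, _ => ⊤
  | n + 1, c => Submodule.span K
      {r | ∃ i j, i + j = c ∧ ∃ u ∈ U i, ∃ e ∈ weightedProd U n j, r = u * e}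

theorem mul_mem_weightedProd {U : ℕ → Submodule K R} {n i j c : ℕ} (h : i + j = c) {u e : R}
    (hu : u ∈ U i) (he : e ∈ weightedProd U n j) : u * e ∈ weightedProd U (n + 1) c :=
  Submodule.subset_span ⟨i, j, h, u, hu, e, he, rfl⟩

theorem weightedProd_succ_le {U : ℕ → Submodule K R} {n c : ℕ} {M : Submodule K R}
    (h : ∀ i j, i + j = c → ∀ u ∈ U i, ∀ e ∈ weightedProd U n j, u * e ∈ M) :
    weightedProd U (n + 1) c ≤ M := by
  refine Submodule.span_le.2 ?_
  rintro _ ⟨i, j, hij, u, hu, e, he, rfl⟩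
  exact h i j hij u hu e he

theorem isStableFiltration_weightedProd
    (hσK : ∀ (x : X) (k : K) (r : R), σ x (k • r) = k • σ x r)
    (hδK : ∀ (x : X) (k : K) (r : R), δ x (k • r) = k • δ x r) {S : Set X}
    {U : ℕ → Submodule K R} (hU : IsStableFiltration σ δ S U) (n : ℕ) :
    IsStableFiltration σ δ S (weightedProd U n) := by
  induction n with
  | zero => exact ⟨fun _ _ _ => le_rfl, fun _ _ _ _ _ => trivial, fun _ _ _ _ _ => trivial⟩
  | succ n ih =>
    refine ⟨monotone_nat_of_le_succ fun c => ?mono, fun x hx c => ?map, fun x hx c => ?deriv⟩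
    case mono =>
      exact weightedProd_succ_le fun i j h u hu e he =>
        mul_mem_weightedProd (i := i + 1) (by omega) (hU.mono (Nat.le_succ i) hu) he
    case map =>
      let f : Module.End K R :=
        { toFun := σ x, map_add' := map_add (σ x), map_smul' := hσK x }
      have hle : weightedProd U (n + 1) c ≤ (weightedProd U (n + 1) c).comap f :=
        weightedProd_succ_le fun i j h u hu e he => by
          change σ x (u * e) ∈ weightedProd U (n + 1) c
          rw [map_mul]
          exact mul_mem_weightedProd h (hU.map_mem x hx i u hu) (ih.map_mem x hx j e he)
      exact hle
    case deriv =>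
      let D : Module.End K R := (δ x).toEnd (hδK x)
      have hle : weightedProd U (n + 1) c ≤ (weightedProd U (n + 1) (c + 1)).comap D :=
        weightedProd_succ_le fun i j h u hu e he => by
          rw [Submodule.mem_comap, (δ x).isSkewDerivation_toEnd (hδK x)]
          exact add_mem
            (mul_mem_weightedProd (i := i + 1) (by omega) (hU.deriv_mem x hx i u hu) he)
            (mul_mem_weightedProd (j := j + 1) (by omega) (hU.map_mem x hx i u hu)
              (ih.deriv_mem x hx j e he))
      exact hle

theorem iterProd_subset_coeffsIn_weightedProd
    (hσK : ∀ (x : X) (k : K) (r : R), σ x (k • r) = k • σ x r)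
    (hδK : ∀ (x : X) (k : K) (r : R), δ x (k • r) = k • δ x r) {S : Set X}
    {U : ℕ → Submodule K R} (hU : IsStableFiltration σ δ S U) {s : Set (FreeSkewExtension σ δ)}
    (hsU : s ⊆ coeffsIn σ δ (U 0)) {d : ℕ}
    (hd : ∀ f ∈ s, ∀ w, f.coeff w ≠ 0 → (∀ x ∈ w.toList, x ∈ S) ∧ w.length ≤ d) (n : ℕ) :
    iterProd s n ⊆ coeffsIn σ δ (weightedProd U n (n * d)) := by
  induction n with
  | zero => exact fun _ _ _ => trivial
  | succ n ih =>
    rintro _ ⟨f, hf, g, hg, rfl⟩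
    refine mul_mem_coeffsIn fun w hw => ?_
    obtain ⟨hwS, hwd⟩ := hd f hf w hw
    have hUn := isStableFiltration_weightedProd hσK hδK hU n
    have hlen : n * d + w.length ≤ (n + 1) * d := by rw [add_one_mul]; omega
    exact coeffMul_mem_coeffsIn
      (fun r hr => mul_mem_weightedProd (zero_add _) (hsU hf w) (hUn.mono hlen hr))
      (hUn.word_apply_mem_coeffsIn w hwS (ih hg))

/-- The submodules generated from `V` under the group `H` and at most `j` applications of the maps
`D x` with `x ∈ S`. -/
def derivTower (H : Subgroup (RingAut R)) (D : X → Module.End K R) (S : Finset X)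
    (V : Submodule K R) : ℕ → Submodule K R
  | 0 => orbitSpan H V
  | j + 1 => orbitSpan H (derivTower H D S V j ⊔ ⨆ x ∈ S, (derivTower H D S V j).map (D x))

theorem isStableFiltration_derivTower (hσK : ∀ (x : X) (k : K) (r : R), σ x (k • r) = k • σ x r)
    (hδK : ∀ (x : X) (k : K) (r : R), δ x (k • r) = k • δ x r) {H : Subgroup (RingAut R)}
    {S : Finset X} (hH : ∀ x ∈ S, σ x ∈ H) (V : Submodule K R) :
    IsStableFiltration σ δ S (derivTower H (fun x => (δ x).toEnd (hδK x)) S V) where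
  mono := monotone_nat_of_le_succ fun _ => le_sup_left.trans (le_orbitSpan ..)
  map_mem x hx j u hu := by cases j <;> exact map_orbitSpan_le (hH x hx) (hσK x) hu
  deriv_mem x hx _ u hu := le_orbitSpan _ _ (Submodule.mem_sup_right
    (Submodule.mem_iSup_of_mem x (Submodule.mem_iSup_of_mem hx ⟨u, hu, rfl⟩)))

theorem fg_derivTower {H : Subgroup (RingAut R)} (D : X → Module.End K R) (S : Finset X)
    {V : Submodule K R} (hH : ∀ V : Submodule K R, V.FG → (orbitSpan H V).FG) (hV : V.FG) (j : ℕ) :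
    (derivTower H D S V j).FG := by
  induction j with
  | zero => exact hH _ hV
  | succ j ih => exact hH _ (ih.sup (Submodule.fg_biSup _ _ fun x _ => ih.map (D x)))

theorem derivTower_le {H : Subgroup (RingAut R)} {D : X → Module.End K R} {S : Finset X}
    {V W : Submodule K R} (hH : H ≤ linearStabilizer W) (hD : ∀ x, ∀ r ∈ W, D x r ∈ W)
    (hV : V ≤ W) (j : ℕ) : derivTower H D S V j ≤ W := by
  induction j with
  | zero => exact orbitSpan_le hH hV
  | succ j ih =>
    refine orbitSpan_le hH (sup_le ih (iSup₂_le fun x _ => ?_))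
    exact Submodule.map_le_iff_le_comap.2 fun u hu => hD x u (ih hu)

variable [IsScalarTower K R R] [SMulCommClass K R R]

-- At most `c / d` of the factors of a product of total index `c` have index at least `d`; all the
-- others lie in `N`.
theorem weightedProd_le_leftPow {U : ℕ → Submodule K R} {N : Submodule K R}
    (hN : IsAlgebraIdeal N) {d : ℕ} (hUN : ∀ j < d, U j ≤ N) (hd : 0 < d) {n c t : ℕ}
    (h : t * d + c ≤ n * d) : weightedProd U n c ≤ leftPow N t := by
  induction n generalizing c t with
  | zero =>
    obtain rfl : t = 0 := by
      have htd : t * d = 0 := by omega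
      exact (Nat.mul_eq_zero.1 htd).resolve_right hd.ne'
    exact le_top
  | succ n ih =>
    refine weightedProd_succ_le fun i j hij u hu e he => ?_
    rw [add_one_mul] at h
    rcases lt_or_ge i d with hi | hi
    · cases t with
      | zero => trivial
      | succ t =>
        rw [add_one_mul] at h
        exact mul_mem_leftPow (hUN i hi hu) (ih (by omega) he)
    · exact (hN.leftPow t).mul_mem_left u e (ih (by omega) he)

end Filtrations

section LocalNilpotence

variable {K R X : Type*} [CommRing K] [NonUnitalRing R] [Module K R]
  {σ : X → RingAut R} {δ : ∀ x, SkewDerivation (σ x)} {T : Submodule K R}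

theorem isSkewInvariant_bot (hσK : ∀ (x : X) (k : K) (r : R), σ x (k • r) = k • σ x r) :
    IsSkewInvariant σ δ (⊥ : Submodule K R) where
  mem_stabilizer x := mem_linearStabilizer.2
    ⟨hσK x, fun r => by
      rw [Submodule.mem_bot, Submodule.mem_bot, map_eq_zero_iff _ (σ x).injective]⟩
  deriv_mem x r hr := by
    rw [(Submodule.mem_bot K).1 hr]
    exact map_zero (δ x).toAddMonoidHom

theorem IsSkewInvariant.sSup (hσK : ∀ (x : X) (k : K) (r : R), σ x (k • r) = k • σ x r)
    {c : Set (Submodule K R)} (hc : IsChain (· ≤ ·) c) (hne : c.Nonempty)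
    (h : ∀ T ∈ c, IsSkewInvariant σ δ T) : IsSkewInvariant σ δ (sSup c) := by
  have hmem : ∀ {r : R}, r ∈ SupSet.sSup c ↔ ∃ T ∈ c, r ∈ T :=
    Submodule.mem_sSup_of_directed hne hc.directedOn
  refine ⟨fun x => mem_linearStabilizer.2 ⟨hσK x, fun r => ?_⟩, fun x r hr => ?_⟩
  · rw [hmem, hmem]
    exact exists_congr fun T => and_congr_right fun hT => ((h T hT).mem_stabilizer x).2 r
  · obtain ⟨T, hT, hrT⟩ := hmem.1 hr
    exact hmem.2 ⟨T, hT, (h T hT).deriv_mem x r hrT⟩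

/-- Every finite set of polynomials over `T` has only zero products of some fixed length. -/
def IsLocallyNilpotentOver (σ : X → RingAut R) (δ : ∀ x, SkewDerivation (σ x))
    (T : Submodule K R) : Prop :=
  ∀ s : Set (FreeSkewExtension σ δ), s.Finite → s ⊆ coeffsIn σ δ T → ∃ n, iterProd s n ⊆ {0}

theorem isLocallyNilpotentOver_bot : IsLocallyNilpotentOver σ δ (⊥ : Submodule K R) :=
  fun _ _ hs => ⟨0, fun f hf => Finsupp.ext (f := (f : FreeMonoid X →₀ R)) fun w => hs hf w⟩

theorem IsLocallyNilpotentOver.sSup {c : Set (Submodule K R)} (hc : IsChain (· ≤ ·) c)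
    (hne : c.Nonempty) (h : ∀ T ∈ c, IsLocallyNilpotentOver σ δ T) :
    IsLocallyNilpotentOver σ δ (sSup c) := by
  intro s hs hsc
  obtain ⟨T, hTc, hT⟩ := (CompleteLattice.isCompactElement_iff_le_of_directed_sSup_le _ _).1
    ((Submodule.fg_iff_compact _).1 (fg_coeffSpan hs)) c hne hc.directedOn (coeffSpan_le_iff.2 hsc)
  exact h T hTc s hs (coeffSpan_le_iff.1 hT)

theorem IsLocallyNilpotentOver.of_iterProd {W : Submodule K R}
    (hT : IsLocallyNilpotentOver σ δ T)
    (h : ∀ s : Set (FreeSkewExtension σ δ), s.Finite → s ⊆ coeffsIn σ δ W →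
      ∃ n, iterProd s n ⊆ coeffsIn σ δ T) : IsLocallyNilpotentOver σ δ W := by
  intro s hs hsW
  obtain ⟨n, hn⟩ := h s hs hsW
  obtain ⟨m, hm⟩ := hT _ (finite_iterProd hs n) hn
  exact ⟨(n + 1) * m + n, iterProd_iterProd s n m ▸ hm⟩

variable [IsScalarTower K R R] [SMulCommClass K R R]

theorem IsSkewInvariant.nilSum (hδK : ∀ (x : X) (k : K) (r : R), δ x (k • r) = k • δ x r)
    (hfin : ∀ (S : Finset X) (V : Submodule K R), V.FG →
      (orbitSpan (Subgroup.closure (σ '' S)) V).FG)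
    {q : X → K} (hq : ∀ (x : X) (r : R), δ x (σ x r) = q x • σ x (δ x r))
    (hq_sum : ∀ (x : X) (n : ℕ), IsUnit (∑ i ∈ Finset.range (n + 1), q x ^ i))
    (hT : IsAlgebraIdeal T) (hinv : IsSkewInvariant σ δ T) : IsSkewInvariant σ δ (nilSum T) where
  mem_stabilizer x := linearStabilizer_le_nilSum T (hinv.mem_stabilizer x)
  deriv_mem x r hr := by
    have hfinx := hfin {x}
    rw [Finset.coe_singleton, Set.image_singleton] at hfinx
    exact ((δ x).isSkewDerivation_toEnd (hδK x)).apply_mem_nilSum hT (hinv.mem_stabilizer x)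
      (hinv.deriv_mem x) (hq x) (hq_sum x) hfinx hr

theorem exists_iterProd_subset_coeffsIn
    (hσK : ∀ (x : X) (k : K) (r : R), σ x (k • r) = k • σ x r)
    (hδK : ∀ (x : X) (k : K) (r : R), δ x (k • r) = k • δ x r)
    (hfin : ∀ (S : Finset X) (V : Submodule K R), V.FG →
      (orbitSpan (Subgroup.closure (σ '' S)) V).FG)
    (hT : IsAlgebraIdeal T) (hinv : IsSkewInvariant σ δ (nilSum T))
    {s : Set (FreeSkewExtension σ δ)} (hs : s.Finite) (hsT : s ⊆ coeffsIn σ δ (nilSum T)) :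
    ∃ n, iterProd s n ⊆ coeffsIn σ δ T := by
  obtain ⟨S, d, hSd⟩ := exists_letters_mem_length_le hs
  let H : Subgroup (RingAut R) := Subgroup.closure (σ '' S)
  have hσH : ∀ x ∈ S, σ x ∈ H := fun x hx => Subgroup.subset_closure ⟨x, hx, rfl⟩
  have hHT : H ≤ linearStabilizer (nilSum T) := (Subgroup.closure_le _).2
    (Set.image_subset_iff.2 fun x _ => hinv.mem_stabilizer x)
  let D : X → Module.End K R := fun x => (δ x).toEnd (hδK x)
  let U : ℕ → Submodule K R := derivTower H D S (coeffSpan K s)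
  have hU : IsStableFiltration σ δ S U := isStableFiltration_derivTower hσK hδK hσH _
  have hsU : s ⊆ coeffsIn σ δ (U 0) := coeffSpan_le_iff.1 (le_orbitSpan H _)
  obtain ⟨N, hN, ⟨k, hk⟩, hUN⟩ := exists_isNilpotentMod_of_fg_le_nilSum hT
    (fg_derivTower D S (hfin S) (fg_coeffSpan hs) (2 * d))
    (derivTower_le (D := D) hHT hinv.deriv_mem (coeffSpan_le_iff.2 hsT) (2 * d))
  have hUlt : ∀ j < 2 * d + 1, U j ≤ N := fun j hj => (hU.mono (Nat.lt_succ_iff.1 hj)).trans hUN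
  -- The coefficients of a product of `n` factors have total index at most `n * d`, so more than
  -- half of the factors have index at most `2 * d`.
  have hcount : k * (2 * d + 1) + 2 * k * d ≤ 2 * k * (2 * d + 1) := by nlinarith
  exact ⟨2 * k, (iterProd_subset_coeffsIn_weightedProd hσK hδK hU hsU hSd _).trans fun f hf w =>
    hk (weightedProd_le_leftPow hN hUlt (Nat.succ_pos _) hcount (hf w))⟩

end LocalNilpotence

-- A scalar multiple `g = k • f` is described by its coefficients, since `FreeSkewExtension` carries
-- a module structure only over fields.
theorem mainTheorem7_general {K R X : Type*} [CommRing K] [NonUnitalRing R] [Module K R]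
    [IsScalarTower K R R] [SMulCommClass K R R]
    (σ : X → RingAut R) (δ : ∀ x, SkewDerivation (σ x))
    (hσK : ∀ (x : X) (k : K) (r : R), σ x (k • r) = k • σ x r)
    (hδK : ∀ (x : X) (k : K) (r : R), δ x (k • r) = k • δ x r)
    (hfin : ∀ (S : Finset X) (V : Submodule K R), V.FG →
      (orbitSpan (Subgroup.closure (σ '' S)) V).FG)
    (q : X → K) (hq : ∀ (x : X) (r : R), δ x (σ x r) = q x • σ x (δ x r))
    (hq_sum : ∀ (x : X) (n : ℕ), IsUnit (∑ i ∈ Finset.range (n + 1), q x ^ i)) :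
    ∃ J : TwoSidedIdeal (FreeSkewExtension σ δ),
      (J : Set (FreeSkewExtension σ δ)) =
          FreeSkewExtension.polynomialsOver σ δ (primeRadical R) ∧
        (∀ k : K, ∀ f ∈ J, ∀ g : FreeSkewExtension σ δ,
          (∀ w, g.coeff w = k • f.coeff w) → g ∈ J) ∧
        IsLocallyNilpotentRing J := by
  obtain ⟨hinv, hnil⟩ : IsSkewInvariant σ δ (primeRadicalSubmodule K R) ∧
      IsLocallyNilpotentOver σ δ (primeRadicalSubmodule K R) := by
    refine primeRadicalSubmodule_induction
      (C := fun T => IsSkewInvariant σ δ T ∧ IsLocallyNilpotentOver σ δ T)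
      ⟨isSkewInvariant_bot hσK, isLocallyNilpotentOver_bot⟩
      (fun T hTI hT => ?_) (fun c hc hne h => ?_)
    · have hinv : IsSkewInvariant σ δ (nilSum T) := hT.1.nilSum hδK hfin hq hq_sum hTI
      exact ⟨hinv, hT.2.of_iterProd fun s hs hsT =>
        exists_iterProd_subset_coeffsIn hσK hδK hfin hTI hinv hs hsT⟩
    · exact ⟨IsSkewInvariant.sSup hσK hc hne fun T hT => (h T hT).1,
        IsLocallyNilpotentOver.sSup hc hne fun T hT => (h T hT).2⟩
  let J : TwoSidedIdeal (FreeSkewExtension σ δ) :=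
    polynomialIdeal isAlgebraIdeal_primeRadicalSubmodule hinv
  have hJ : ∀ {f}, f ∈ J ↔ f ∈ coeffsIn σ δ (primeRadicalSubmodule K R) :=
    mem_polynomialIdeal isAlgebraIdeal_primeRadicalSubmodule hinv
  refine ⟨J, Set.ext fun f => hJ, fun k f hf g hg => hJ.2 fun w => ?_,
    isLocallyNilpotentRing_of_iterProd_subset fun s hs hsJ => hnil s hs fun f hf => hJ.1 (hsJ hf)⟩
  rw [hg]
  exact Submodule.smul_mem _ k (hJ.1 hf w)

end

theorem mainTheorem7 {K R X : Type*} [Field K] [NonUnitalRing R] [Module K R]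
    [IsScalarTower K R R] [SMulCommClass K R R]
    (σ : X → RingAut R) (δ : ∀ x, SkewDerivation (σ x))
    (hσK : ∀ (x : X) (k : K) (r : R), σ x (k • r) = k • σ x r)
    (hδK : ∀ (x : X) (k : K) (r : R), δ x (k • r) = k • δ x r)
    (hfin : IsLocallyFiniteFamily K σ)
    (q : X → Kˣ)
    (hq : ∀ (x : X) (r : R), δ x (σ x r) = (q x : K) • σ x (δ x r))
    (hq_sum : ∀ (x : X) (n : ℕ), 0 < n → ∑ i ∈ Finset.range (n + 1), (q x : K) ^ i ≠ 0) :
    ∃ J : TwoSidedIdeal (FreeSkewExtension σ δ),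
      (J : Set (FreeSkewExtension σ δ)) =
          FreeSkewExtension.polynomialsOver σ δ (primeRadical R) ∧
        (∀ (k : K), ∀ f ∈ J, k • f ∈ J) ∧
        IsLocallyNilpotentRing J := by
  obtain ⟨J, hJ, hsmul, hnil⟩ := mainTheorem7_general σ δ hσK hδK
    (fun S V hV => hfin _ (Set.image_subset_range _ _) (S.finite_toSet.image σ) V hV)
    (fun x => (q x : K)) hq fun x n => by
      rcases n.eq_zero_or_pos with rfl | hn
      · simp
      · exact (hq_sum x n hn).isUnit
  exact ⟨J, hJ, fun k f hf => hsmul k f hf _ fun _ => rfl, hnil⟩
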